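/- **Model.** Let $N\ge 2$, $\mu,\varpi\in(0,1)$ and $\tfrac12\le p_L<p_H<1$. A state $\theta\in\{0,1\}$ with $\Pr(\theta=1)=\mu$ and precisions $p_1,\dots,p_N\in\{p_L,p_H\}$ with $\Pr(p_i=p_H)=\varpi$ are drawn once, independently. At each date $t=1,2,\dots$ expert $i$ observes a signal $s^i_t\in\{0,1\}$ with $\Pr(s^i_t=\theta\mid\theta,p_i)=p_i$, independently across $i$ and $t$ given $(\theta,p_1,\dots,p_N)$, and publishes a report $y^i_t\in\{0,1\}$. Put $Y_{1:t}=(y^i_u)_{u\le t,\,i\le N}$, $\lambda_t=\Pr(\theta=1\mid Y_{1:t})$ and $\rho^i_t=\Pr(p_i=p_H\mid Y_{1:t})$ (so $\lambda_0=\mu$, $\rho^i_0=\varpi$), and $\operatorname{logit}(\lambda)=\log\frac{\lambda}{1-\lambda}$. **Equilibrium.** Let $\kappa\ge 0$ be a deviation cost. A low-type strategy $\sigma$ prescribes, for each belief $\lambda\in(0,1)$ and signal $s$, the probability $\sigma(s;\lambda)\in[0,1]$ of reporting $1$. Let $\ell_H(y;\lambda)$ and $\ell_L(y;\lambda)$ be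 the probabilities of the report $y$ by a truthful type-$p_H$ expert and by a type-$p_L$ expert who uses $\sigma(\cdot\,;\lambda)$, when $\theta=1$ has probability $\lambda$, and let $$\rho^+(y;\lambda)=\frac{\varpi\,\ell_H(y;\lambda)}{\varpi\,\ell_H(y;\lambda)+(1-\varpi)\,\ell_L(y;\lambda)} .$$ The strategy $\sigma$ is a *one-sided mixing equilibrium* (with truthful high type) if $\sigma(0;\lambda)=0$ for $\lambda<\tfrac12$, $\sigma(1;\lambda)=1$ for $\lambda>\tfrac12$, $\sigma(s;\tfrac12)=s$, and if for every $\lambda\in(0,1)$ and every signal $s$ both reporting $1$ with probability $\sigma(s;\lambda)$ (low type) and reporting $s$ (high type) maximize the expectation of $\rho^+(y;\lambda)-\kappa\,\mathbf 1\{y\ne s\}$ over the distributions of $y\in\{0,1\}$. (For $\kappa=0$ this means, with $A(p;\lambda)=(1-\lambda)+(2\lambda-1)p$, that $\sigma(1;\lambda)=A(p_H;\lambda)/A(p_L;\lambda)$ for $\lambda<\tfrac12$ and $\sigma(0;\lambda)=\frac{A(p_H;\lambda)-A(p_L;\lambda)}{1-A(p_L;\lambda)}$ for $\lambda>\tfrac12$.)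 **Design.** Let $\mathcal E\subset\{1,2,\dots\}$ be the set of evaluation dates. At dates $t\in\mathcal E$ all experts report truthfully, $y^i_t=s^i_t$. At dates $t\notin\mathcal E$ the high type reports truthfully and the low type reports $1$ with probability $\sigma(s^i_t;\lambda_{t-1})$, where $\sigma$ is a one-sided mixing equilibrium; the randomizations are independent across experts given the past and the current signals. Assume that $\mathcal E$ has positive lower density, $\liminf_n |\mathcal E\cap\{1,\dots,n\}|/n>0$, or that $\kappa>0$. For an expert of type $p\in\{p_L,p_H\}$, let $\ell_{p,t}(y\mid b;\lambda)$ be the probability of the report $y$ at date $t$ if $\theta=b$ and $\lambda_{t-1}=\lambda$, and let $$r_t(y;\lambda,\rho)=\frac{\rho\,\ell_{p_H,t}(y\mid 1;\lambda)+(1-\rho)\,\ell_{p_L,t}(y\mid 1;\lambda)}{\rho\,\ell_{p_H,t}(y\mid 0;\lambda)+(1-\rho)\,\ell_{p_L,t}(y\mid 0;\lambda)},\qquad \Lambda_T=\sum_{t=1}^{T}\sum_{i=1}^N\log r_t\big(y^i_t;\lambda_{t-1},\rho^i_{t-1}\big).$$ **Lemma.** Almost surely on the event that at least one expert has $p_i>\tfrac12$: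 1. $\lambda_t\to\mathbf 1\{\theta=1\}$ as $t\to\infty$; 2. the log-odds $\operatorname{logit}(\lambda_t)$ and the cumulative log-likelihood $\Lambda_t$ both diverge to $+\infty$ if $\theta=1$ and to $-\infty$ if $\theta=0$; 3. $\rho^i_t\to\mathbf 1\{p_i=p_H\}$ as $t\to\infty$ for every expert $i$. -/

import Mathlib

open MeasureTheory ProbabilityTheory Filter Topology

noncomputable section

namespace ExpertPanel

/-- The primitives of the binary model with observer design. States, signals and reports are
Booleans (`true` is `1`); expert types are Booleans (`true` is high precision). -/
structure Params where
  /-- prior probability of the state `1` -/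
  μ : ℝ
  /-- prior probability that an expert is of the high type -/
  ϖ : ℝ
  /-- precision of the low type -/
  pL : ℝ
  /-- precision of the high type -/
  pH : ℝ
  /-- cost of a report that differs from one's own signal (`0` if no cost is imposed) -/
  κ : ℝ
  /-- the announced evaluation dates, a set of dates in `{1, 2, …}` -/
  E : Set ℕ

/-- The precision of an expert of the given type. -/
def Params.prec (M : Params) (high : Bool) : ℝ := if high then M.pH else M.pL

/-- The mass that the Bernoulli distribution with parameter `q` gives to `y`. -/
def coin (q : ℝ) (y : Bool) : ℝ := if y then q else 1 - q

/-- Probability of the signal `s` in state `b` for an expert of precision `p`. -/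
def signalProb (p : ℝ) (b s : Bool) : ℝ := if s = b then p else 1 - p

/-- A one-period reporting rule: the probability of reporting `1` after each signal. -/
abbrev Rule := Bool → ℝ

/-- Reporting one's own signal. -/
def truthful : Rule := fun s => if s then 1 else 0

/-- `ℓ_p(y ∣ b)`: probability of the report `y` in state `b`. -/
def reportProb (p : ℝ) (r : Rule) (b y : Bool) : ℝ :=
  ∑ s : Bool, signalProb p b s * coin (r s) y

/-- `ℓ_p(y; l)`: probability of the report `y` if state `1` has probability `l`. -/
def marginalProb (p : ℝ) (r : Rule) (l : ℝ) (y : Bool) : ℝ :=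
  l * reportProb p r true y + (1 - l) * reportProb p r false y

/-- The one-step reputation `ρ⁺(y; l)` when the high type is truthful and the low type uses `r`. -/
def reputationUpdate (M : Params) (r : Rule) (l : ℝ) (y : Bool) : ℝ :=
  M.ϖ * marginalProb M.pH truthful l y /
    (M.ϖ * marginalProb M.pH truthful l y + (1 - M.ϖ) * marginalProb M.pL r l y)

/-- Payoff from the report `y` after the signal `s`: reputation minus the deviation cost. -/
def payoff (M : Params) (r : Rule) (l : ℝ) (s y : Bool) : ℝ :=
  reputationUpdate M r l y - if y = s then 0 else M.κ

/-- Reporting `1` with probability `q` is optimal after the signal `s`, when the observer expects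
the low type to use `r`. -/
def IsBestReply (M : Params) (r : Rule) (l : ℝ) (s : Bool) (q : ℝ) : Prop :=
  q ∈ Set.Icc (0 : ℝ) 1 ∧ ∀ q' ∈ Set.Icc (0 : ℝ) 1,
    q' * payoff M r l s true + (1 - q') * payoff M r l s false ≤
      q * payoff M r l s true + (1 - q) * payoff M r l s false

/-- The stationary strategy `σ` of the low type (a reporting rule for each public belief `l`)
forms, with a truthful high type, a one-sided mixing equilibrium: below `1/2` the low type
distorts at most after the signal `1`, above `1/2` at most after the signal `0`, at `1/2` he is
truthful, and both types reply optimally. -/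
structure IsOneSidedEquilibrium (M : Params) (σ : ℝ → Rule) : Prop where
  below : ∀ l, 0 < l → l < 1 / 2 → σ l false = 0
  above : ∀ l, 1 / 2 < l → l < 1 → σ l true = 1
  half : σ (1 / 2) = truthful
  low_optimal : ∀ l, 0 < l → l < 1 → ∀ s, IsBestReply M (σ l) l s (σ l s)
  high_optimal : ∀ l, 0 < l → l < 1 → ∀ s, IsBestReply M (σ l) l s (truthful s)

/-- `A(p; l)`, the probability of the signal `1` at precision `p` and belief `l`. -/
def signalOne (p l : ℝ) : ℝ := (1 - l) + (2 * l - 1) * p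

lemma payoff_diff (M : Params) (r : Rule) (l : ℝ) (h0 : M.κ = 0)
    (hϖ0 : 0 < M.ϖ) (hϖ1 : M.ϖ < 1) (hH0 : 0 < signalOne M.pH l) (hH1 : signalOne M.pH l < 1)
    (hm0 : 0 ≤ signalOne M.pL l * r true + (1 - signalOne M.pL l) * r false)
    (hm1 : signalOne M.pL l * r true + (1 - signalOne M.pL l) * r false ≤ 1) :
    ∃ c : ℝ, 0 < c ∧ ∀ s, payoff M r l s true - payoff M r l s false =
      c * (signalOne M.pH l - (signalOne M.pL l * r true + (1 - signalOne M.pL l) * r false)) := by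
  set a := signalOne M.pH l with ha
  set m := signalOne M.pL l * r true + (1 - signalOne M.pL l) * r false with hm
  have e1 : marginalProb M.pH truthful l true = a := by
    simp [marginalProb, reportProb, signalProb, coin, truthful, ha, signalOne]; ring
  have e2 : marginalProb M.pH truthful l false = 1 - a := by
    simp [marginalProb, reportProb, signalProb, coin, truthful, ha, signalOne]; ring
  have e3 : marginalProb M.pL r l true = m := by
    simp [marginalProb, reportProb, signalProb, coin, hm, signalOne]; ring
  have e4 : marginalProb M.pL r l false = 1 - m := by
    simp [marginalProb, reportProb, signalProb, coin, hm, signalOne]; ring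
  have hw : 0 < 1 - M.ϖ := by linarith
  have d1 : 0 < M.ϖ * a + (1 - M.ϖ) * m := by positivity
  have d2 : 0 < M.ϖ * (1 - a) + (1 - M.ϖ) * (1 - m) := by
    have : 0 < 1 - a := by linarith
    have : 0 ≤ 1 - m := by linarith
    positivity
  refine ⟨M.ϖ * (1 - M.ϖ) / ((M.ϖ * a + (1 - M.ϖ) * m) *
    (M.ϖ * (1 - a) + (1 - M.ϖ) * (1 - m))), by positivity, fun s => ?_⟩
  simp only [payoff, reputationUpdate, e1, e2, e3, e4, h0, ite_self, sub_zero]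
  have d1' := d1.ne'
  have d2' := d2.ne'
  rw [div_sub_div _ _ d1' d2', div_mul_eq_mul_div]
  congr 1
  ring

/-- Without deviation costs, the one-sided mixing equilibrium is given by the closed forms
`α(l) = A(p_H; l) / A(p_L; l)` and `β(l) = (A(p_H; l) - A(p_L; l)) / (1 - A(p_L; l))`. -/
theorem isOneSidedEquilibrium_iff (M : Params) (σ : ℝ → Rule) (h0 : M.κ = 0)
    (hϖ0 : 0 < M.ϖ) (hϖ1 : M.ϖ < 1) (hpL : 1 / 2 ≤ M.pL) (hpLH : M.pL < M.pH) (hpH : M.pH < 1) :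
    IsOneSidedEquilibrium M σ ↔
      (∀ l, 0 < l → l < 1 / 2 → σ l false = 0 ∧
        σ l true = signalOne M.pH l / signalOne M.pL l) ∧
      (∀ l, 1 / 2 < l → l < 1 → σ l true = 1 ∧
        σ l false = (signalOne M.pH l - signalOne M.pL l) / (1 - signalOne M.pL l)) ∧
      σ (1 / 2) = truthful := by
  have hA : ∀ p l : ℝ, 1 / 2 ≤ p → p < 1 → 0 < l → l < 1 →
      0 < signalOne p l ∧ signalOne p l < 1 := by
    intro p l h1 h2 h3 h4
    constructor <;> simp only [signalOne] <;> nlinarith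
  have hlt : ∀ l : ℝ, l < 1 / 2 → signalOne M.pH l < signalOne M.pL l := by
    intro l h; simp only [signalOne]; nlinarith
  have hgt : ∀ l : ℝ, 1 / 2 < l → signalOne M.pL l < signalOne M.pH l := by
    intro l h; simp only [signalOne]; nlinarith
  constructor
  · intro h
    refine ⟨fun l l0 l1 => ⟨h.below l l0 l1, ?_⟩, fun l l0 l1 => ⟨h.above l l0 l1, ?_⟩, h.half⟩
    · obtain ⟨⟨q0, q1⟩, hq⟩ := h.low_optimal l l0 (by linarith) true
      obtain ⟨a0, a1⟩ := hA M.pH l (by linarith) hpH l0 (by linarith)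
      obtain ⟨b0, b1⟩ := hA M.pL l hpL (by linarith) l0 (by linarith)
      have hb := h.below l l0 l1
      obtain ⟨c, c0, hc⟩ := payoff_diff M (σ l) l h0 hϖ0 hϖ1 a0 a1
        (by rw [hb]; nlinarith) (by rw [hb]; nlinarith)
      have hc := hc true
      rw [hb] at hc
      have t1 := hq 1 (by simp)
      have t0 := hq 0 (by simp)
      have hl := hlt l l1
      rw [eq_div_iff b0.ne']
      generalize payoff M (σ l) l true true = u at *
      generalize payoff M (σ l) l true false = w at *
      generalize σ l true = q at *
      rcases lt_trichotomy (signalOne M.pH l) (signalOne M.pL l * q) with hh | hh | hh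
      · have : u - w < 0 := by rw [hc]; nlinarith
        have : q ≤ 0 := by nlinarith
        nlinarith
      · linarith
      · have : 0 < u - w := by rw [hc]; nlinarith
        have : 1 ≤ q := by nlinarith
        nlinarith
    · obtain ⟨⟨q0, q1⟩, hq⟩ := h.low_optimal l (by linarith) l1 false
      obtain ⟨a0, a1⟩ := hA M.pH l (by linarith) hpH (by linarith) l1
      obtain ⟨b0, b1⟩ := hA M.pL l hpL (by linarith) (by linarith) l1
      have hb := h.above l l0 l1
      obtain ⟨c, c0, hc⟩ := payoff_diff M (σ l) l h0 hϖ0 hϖ1 a0 a1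
        (by rw [hb]; nlinarith) (by rw [hb]; nlinarith)
      have hc := hc false
      rw [hb] at hc
      have t1 := hq 1 (by simp)
      have t0 := hq 0 (by simp)
      have hl := hgt l l0
      rw [eq_div_iff (by linarith)]
      generalize payoff M (σ l) l false true = u at *
      generalize payoff M (σ l) l false false = w at *
      generalize σ l false = q at *
      rcases lt_trichotomy (signalOne M.pH l)
        (signalOne M.pL l * 1 + (1 - signalOne M.pL l) * q) with hh | hh | hh
      · have : u - w < 0 := by rw [hc]; nlinarith
        have : q ≤ 0 := by nlinarith
        nlinarith
      · linarith
      · have : 0 < u - w := by rw [hc]; nlinarith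
        have : 1 ≤ q := by nlinarith
        nlinarith
  · rintro ⟨hb, ha, hh⟩
    have key : ∀ l, 0 < l → l < 1 → (∀ s, σ l s ∈ Set.Icc (0 : ℝ) 1) ∧
        signalOne M.pL l * σ l true + (1 - signalOne M.pL l) * σ l false = signalOne M.pH l := by
      intro l l0 l1
      obtain ⟨a0, a1⟩ := hA M.pH l (by linarith) hpH l0 l1
      obtain ⟨b0, b1⟩ := hA M.pL l hpL (by linarith) l0 l1
      have b2 : 0 < 1 - signalOne M.pL l := by linarith
      rcases lt_trichotomy l (1 / 2) with hl | hl | hl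
      · obtain ⟨e1, e2⟩ := hb l l0 hl
        have := hlt l hl
        refine ⟨fun s => ?_, by rw [e1, e2]; field_simp; ring⟩
        cases s
        · simp [e1]
        · rw [e2]; exact ⟨by positivity, by rw [div_le_one b0]; linarith⟩
      · subst hl
        rw [hh]
        refine ⟨fun s => by cases s <;> simp [truthful], by simp [truthful, signalOne]⟩
      · obtain ⟨e1, e2⟩ := ha l hl l1
        have := hgt l hl
        refine ⟨fun s => ?_, by rw [e1, e2]; field_simp; ring⟩
        cases s
        · rw [e2]; exact ⟨div_nonneg (by linarith) b2.le, by rw [div_le_one b2]; linarith⟩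
        · simp [e1]
    have opt : ∀ l, 0 < l → l < 1 → ∀ s q, q ∈ Set.Icc (0 : ℝ) 1 →
        IsBestReply M (σ l) l s q := by
      intro l l0 l1 s q hq
      obtain ⟨-, hm⟩ := key l l0 l1
      obtain ⟨a0, a1⟩ := hA M.pH l (by linarith) hpH l0 l1
      obtain ⟨c, -, hc⟩ := payoff_diff M (σ l) l h0 hϖ0 hϖ1 a0 a1 (by linarith) (by linarith)
      have hc := hc s
      rw [hm, sub_self, mul_zero, sub_eq_zero] at hc
      refine ⟨hq, fun q' _ => ?_⟩
      rw [hc]; linarith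
    exact ⟨fun l l0 l1 => (hb l l0 l1).1, fun l l0 l1 => (ha l l0 l1).1, hh,
      fun l l0 l1 s => opt l l0 l1 s _ ((key l l0 l1).1 s),
      fun l l0 l1 s => opt l l0 l1 s _ (by cases s <;> simp [truthful])⟩

open Classical in
/-- The rule used at date `t` and public belief `l`: both types are truthful at evaluation dates;
at the other dates the high type is truthful and the low type uses `σ`. -/
def ruleAt (M : Params) (σ : ℝ → Rule) (t : ℕ) (l : ℝ) (high : Bool) : Rule :=
  if t ∈ M.E then truthful else if high then truthful else σ l

open Classical in
/-- The lower asymptotic density of a set of dates in `{1, 2, …}`. -/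
def lowerDensity (E : Set ℕ) : ℝ :=
  liminf (fun n : ℕ => (((Finset.Icc 1 n).filter (· ∈ E)).card : ℝ) / n) atTop

section Dynamics

variable {Ω : Type*} [MeasurableSpace Ω] {N : ℕ}

/-- The event that the reports of the first `T` periods are those of `h`. In reports, signals and
histories, index `t` stands for date `t + 1`. -/
def historyEvent (y : ℕ → Fin N → Ω → Bool) (T : ℕ) (h : ℕ → Fin N → Bool) : Set Ω :=
  {ω | ∀ t < T, ∀ i, y t i ω = h t i}

/-- Conditional probability of the state `1` given the report history `h` of `T` periods. -/
def belief (P : Measure Ω) (θ : Ω → Bool) (y : ℕ → Fin N → Ω → Bool) (T : ℕ)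
    (h : ℕ → Fin N → Bool) : ℝ :=
  (P[|historyEvent y T h]).real {ω | θ ω = true}

/-- The public belief `λ_T = Pr(θ = 1 ∣ Y_{1:T})`. -/
def publicBelief (P : Measure Ω) (θ : Ω → Bool) (y : ℕ → Fin N → Ω → Bool) (T : ℕ) (ω : Ω) : ℝ :=
  belief P θ y T (fun t i => y t i ω)

/-- The reputation `ρ^i_T = Pr(p_i = p_H ∣ Y_{1:T})`. -/
def reputation (P : Measure Ω) (τ : Fin N → Ω → Bool) (y : ℕ → Fin N → Ω → Bool) (i : Fin N)
    (T : ℕ) (ω : Ω) : ℝ :=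
  (P[|historyEvent y T (fun t j => y t j ω)]).real {ω' | τ i ω' = true}

/-- State `θ`, types `τ`, signals `s` and reports `y` follow the model when the low type uses `σ`:
the state and the types are independent draws from the priors; given these, signals are independent
across experts and dates; and each report is drawn from the rule prescribed by the date, the
expert's type, the current public belief and the expert's signal, independently across experts
given these. -/
structure IsPlay (M : Params) (σ : ℝ → Rule) (P : Measure Ω) (θ : Ω → Bool)
    (τ : Fin N → Ω → Bool) (s y : ℕ → Fin N → Ω → Bool) : Prop where
  measurable_state : Measurable θ
  measurable_type : ∀ i, Measurable (τ i)
  measurable_signal : ∀ t i, Measurable (s t i)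
  measurable_report : ∀ t i, Measurable (y t i)
  law : ∀ (T : ℕ) (b : Bool) (v : Fin N → Bool) (x h : ℕ → Fin N → Bool),
    P.real {ω | θ ω = b ∧ (∀ i, τ i ω = v i) ∧
        ∀ t < T, ∀ i, s t i ω = x t i ∧ y t i ω = h t i} =
      coin M.μ b * (∏ i, coin M.ϖ (v i)) *
        ∏ t ∈ Finset.range T, ∏ i,
          (signalProb (M.prec (v i)) b (x t i) *
            coin (ruleAt M σ (t + 1) (belief P θ y t h) (v i) (x t i)) (h t i))

/-- The likelihood ratio `r_i(y; l, ρ)` of a report at date `t`. -/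
def likelihoodRatio (M : Params) (σ : ℝ → Rule) (t : ℕ) (l ρ : ℝ) (y : Bool) : ℝ :=
  (ρ * reportProb M.pH (ruleAt M σ t l true) true y +
      (1 - ρ) * reportProb M.pL (ruleAt M σ t l false) true y) /
    (ρ * reportProb M.pH (ruleAt M σ t l true) false y +
      (1 - ρ) * reportProb M.pL (ruleAt M σ t l false) false y)

/-- The cumulative log-likelihood `∑_{t=1}^T ∑_i log r_i(y^i_t; λ_{t-1}, ρ^i_{t-1})`. -/
def cumLogLikelihood (M : Params) (σ : ℝ → Rule) (P : Measure Ω) (θ : Ω → Bool)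
    (τ : Fin N → Ω → Bool) (y : ℕ → Fin N → Ω → Bool) (T : ℕ) (ω : Ω) : ℝ :=
  ∑ t ∈ Finset.range T, ∑ i,
    Real.log (likelihoodRatio M σ (t + 1) (publicBelief P θ y t ω) (reputation P τ y i t ω)
      (y t i ω))

end Dynamics

/-- The log-odds of a probability. -/
def logit (l : ℝ) : ℝ := Real.log (l / (1 - l))

end ExpertPanel

end

/-! The hidden state is the pair `x` of the state and the type profile; it takes finitely many
values. Given `x`, the report profiles form a process whose transition law depends on the past only
through the public belief, and it factors over experts. Two hidden states are therefore compared
date by date through Bhattacharyya coefficients, the means under `x` of the square root of the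
one-step likelihood ratio of `x'` to `x`.

These coefficients never exceed 1. At evaluation dates, and at all dates if `κ > 0`, they are at
most `exp (-(c ^ 2 / 4))` with `c` independent of the belief. The reason is that a costly distortion
must be repaid in reputation, which forces the low type's reports away from those of the high type
(`exists_separation`, `exists_reportLaw_separation`). Such dates have positive frequency, so the
mean of the square root of the cumulative likelihood ratio decays geometrically. By Tonelli these
square roots are almost surely summable and hence vanish (`ae_tendsto_prod_zero`). Every rival `x'`
is thus ruled out and posteriors concentrate on `x`, which gives the limits of the belief, its
log-odds and the reputations.

The cumulative log-likelihood needs a second argument, since it is built from marginal reputations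
and not from exact Bayes factors. Once each reputation puts weight at least `w`, close to 1, on the
true type, the mixed law dominates `w` times the true law, so the same square-root estimate survives
with a loss of `w⁻¹` per expert. An informative expert moves the ratio at every date, because
equilibrium rules keep a gap of at least `1 - pH` between the two signals (`rule_gap`). The one-step
mean is then at most some `β < 1`, and the same summability argument applies
(`ae_tendsto_prod_mixedLaw`). -/

namespace ExpertPanel

/-! ### Affinity of two-point distributions -/

/-- The Bhattacharyya coefficient of two distributions on two points. -/
lemma sum_sqrt_mul_le {f g : Bool → ℝ} (hf : ∀ y, 0 ≤ f y) (hg : ∀ y, 0 ≤ g y)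
    (hf1 : ∑ y, f y = 1) (hg1 : ∑ y, g y = 1) :
    ∑ y, √(f y * g y) ≤ 1 - (f true - g true) ^ 2 / 4 := by
  simp only [Fintype.sum_bool] at *
  rw [Real.sqrt_mul (hf _), Real.sqrt_mul (hf _)]
  have a2 := Real.sq_sqrt (hf true)
  have b2 := Real.sq_sqrt (hf false)
  have c2 := Real.sq_sqrt (hg true)
  have d2 := Real.sq_sqrt (hg false)
  have a0 := Real.sqrt_nonneg (f true)
  have b0 := Real.sqrt_nonneg (f false)
  have c0 := Real.sqrt_nonneg (g true)
  have d0 := Real.sqrt_nonneg (g false)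
  generalize √(f true) = a at *
  generalize √(f false) = b at *
  generalize √(g true) = c at *
  generalize √(g false) = d at *
  have a1 : a ≤ 1 := by nlinarith
  have b1 : b ≤ 1 := by nlinarith
  have c1 : c ≤ 1 := by nlinarith
  have d1 : d ≤ 1 := by nlinarith
  -- In terms of square roots, 1 minus the coefficient is `((a - c) ^ 2 + (b - d) ^ 2) / 2`; each
  -- square is at least a quarter of the squared difference of masses, as `x + z ≤ 2`.
  have key : ∀ x z : ℝ, 0 ≤ x → x ≤ 1 → 0 ≤ z → z ≤ 1 →
      (x ^ 2 - z ^ 2) ^ 2 ≤ 4 * (x - z) ^ 2 := by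
    intro x z hx hx1 hz hz1
    have e : (x ^ 2 - z ^ 2) ^ 2 = (x + z) ^ 2 * (x - z) ^ 2 := by ring
    rw [e]
    exact mul_le_mul_of_nonneg_right (by nlinarith) (sq_nonneg _)
  have k1 := key a c a0 a1 c0 c1
  have k2 := key b d b0 b1 d0 d1
  have e1 : (b ^ 2 - d ^ 2) ^ 2 = (f true - g true) ^ 2 := by
    rw [b2, d2, show f false = 1 - f true by linarith, show g false = 1 - g true by linarith]
    ring
  rw [a2, c2] at k1
  rw [e1] at k2
  nlinarith

/-! ### Incentives and equilibrium reporting rules -/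

/-- The parameter restrictions of the model. -/
structure Params.Admissible (M : Params) : Prop where
  prior_pos : 0 < M.μ
  prior_lt_one : M.μ < 1
  high_pos : 0 < M.ϖ
  high_lt_one : M.ϖ < 1
  half_le_low : 1 / 2 ≤ M.pL
  low_lt_high : M.pL < M.pH
  high_prec_lt_one : M.pH < 1
  cost_nonneg : 0 ≤ M.κ

lemma reportProb_true (p : ℝ) (r : Rule) (b : Bool) :
    reportProb p r b true = if b then p * r true + (1 - p) * r false
      else (1 - p) * r true + p * r false := by
  cases b <;> simp [reportProb, signalProb, coin]

lemma sum_reportProb (p : ℝ) (r : Rule) (b : Bool) : ∑ y, reportProb p r b y = 1 := by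
  cases b <;> simp [reportProb, signalProb, coin] <;> ring

lemma reportProb_pos {p : ℝ} {r : Rule} (hp0 : 0 < p) (hp1 : p < 1) (hr0 : 0 ≤ r false)
    (hr1 : r true ≤ 1) (hr : r false < r true) (b y : Bool) : 0 < reportProb p r b y := by
  cases b <;> cases y <;> simp [reportProb, signalProb, coin] <;>
    nlinarith [mul_pos hp0 (sub_pos.2 hp1)]

lemma reportProb_sub (p : ℝ) (r : Rule) :
    reportProb p r true true - reportProb p r false true =
      (2 * p - 1) * (r true - r false) := by
  simp [reportProb_true]; ring

/-- The reputation gain from reporting `1` is proportional to the difference of the marginal report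
probabilities. The upper bound on `c` holds because the high type gives each report probability at
least `1 - pH`, which keeps both denominators above `ϖ * (1 - pH)`. It converts a cost `κ` into a
lower bound on the shift of the marginals. -/
lemma payoff_sub (M : Params) (hM : M.Admissible) (r : Rule) (l : ℝ) (s : Bool)
    (hl0 : 0 < l) (hl1 : l < 1) (hr : ∀ s, 0 ≤ r s ∧ r s ≤ 1) :
    ∃ c : ℝ, 0 < c ∧ c * (M.ϖ * (1 - M.pH) ^ 2) ≤ 1 ∧
      payoff M r l s true - payoff M r l s false =
        c * (signalOne M.pH l - (signalOne M.pL l * r true + (1 - signalOne M.pL l) * r false)) +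
          if s then M.κ else - M.κ := by
  have h1 := hM.high_pos
  have h2 := hM.high_lt_one
  have h3 := hM.half_le_low
  have h4 := hM.low_lt_high
  have h5 := hM.high_prec_lt_one
  set a := signalOne M.pH l with ha
  set m := signalOne M.pL l * r true + (1 - signalOne M.pL l) * r false with hm
  have a0 : 1 - M.pH ≤ a := by simp only [ha, signalOne]; nlinarith
  have a1 : 1 - M.pH ≤ 1 - a := by simp only [ha, signalOne]; nlinarith
  have b0 : 0 ≤ signalOne M.pL l := by simp only [signalOne]; nlinarith
  have b1 : 0 ≤ 1 - signalOne M.pL l := by simp only [signalOne]; nlinarith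
  have m0 : 0 ≤ m := add_nonneg (mul_nonneg b0 (hr _).1) (mul_nonneg b1 (hr _).1)
  have m1 : 0 ≤ 1 - m := by
    have := mul_le_mul_of_nonneg_left (hr true).2 b0
    have := mul_le_mul_of_nonneg_left (hr false).2 b1
    linarith
  have e1 : marginalProb M.pH truthful l true = a := by
    simp [marginalProb, reportProb, signalProb, coin, truthful, ha, signalOne]; ring
  have e2 : marginalProb M.pH truthful l false = 1 - a := by
    simp [marginalProb, reportProb, signalProb, coin, truthful, ha, signalOne]; ring
  have e3 : marginalProb M.pL r l true = m := by
    simp [marginalProb, reportProb, signalProb, coin, hm, signalOne]; ring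
  have e4 : marginalProb M.pL r l false = 1 - m := by
    simp [marginalProb, reportProb, signalProb, coin, hm, signalOne]; ring
  have hw : 0 < 1 - M.ϖ := by linarith
  have hH : 0 < 1 - M.pH := by linarith
  have d1 : M.ϖ * (1 - M.pH) ≤ M.ϖ * a + (1 - M.ϖ) * m := by
    have := mul_le_mul_of_nonneg_left a0 h1.le
    have := mul_nonneg hw.le m0
    linarith
  have d2 : M.ϖ * (1 - M.pH) ≤ M.ϖ * (1 - a) + (1 - M.ϖ) * (1 - m) := by
    have := mul_le_mul_of_nonneg_left a1 h1.le
    have := mul_nonneg hw.le m1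
    linarith
  have hk : 0 < M.ϖ * (1 - M.pH) := by positivity
  have d1' := hk.trans_le d1
  have d2' := hk.trans_le d2
  refine ⟨M.ϖ * (1 - M.ϖ) / ((M.ϖ * a + (1 - M.ϖ) * m) *
    (M.ϖ * (1 - a) + (1 - M.ϖ) * (1 - m))), by positivity, ?_, ?_⟩
  · rw [div_mul_eq_mul_div, div_le_one (by positivity)]
    refine le_trans ?_ (mul_le_mul d1 d2 hk.le d1'.le)
    have : M.ϖ ^ 2 * (1 - M.pH) ^ 2 * (1 - M.ϖ) ≤ M.ϖ ^ 2 * (1 - M.pH) ^ 2 * 1 :=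
      mul_le_mul_of_nonneg_left (by linarith) (by positivity)
    linarith
  · have e5 : M.ϖ * a / (M.ϖ * a + (1 - M.ϖ) * m) -
        M.ϖ * (1 - a) / (M.ϖ * (1 - a) + (1 - M.ϖ) * (1 - m)) =
        M.ϖ * (1 - M.ϖ) / ((M.ϖ * a + (1 - M.ϖ) * m) *
          (M.ϖ * (1 - a) + (1 - M.ϖ) * (1 - m))) * (a - m) := by
      rw [div_sub_div _ _ d1'.ne' d2'.ne', div_mul_eq_mul_div]
      congr 1
      ring
    simp only [payoff, reputationUpdate, e1, e2, e3, e4]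
    rw [← e5]
    cases s <;> simp <;> ring

/-- Below `1/2`, a distorting low type reports `1` too often on average. -/
lemma IsOneSidedEquilibrium.below_bound {M : Params} {σ : ℝ → Rule}
    (hσ : IsOneSidedEquilibrium M σ) (hM : M.Admissible) {l : ℝ} (hl0 : 0 < l) (hl : l < 1 / 2)
    (hlt : σ l true < 1) :
    M.κ * (M.ϖ * (1 - M.pH) ^ 2) ≤ signalOne M.pL l * σ l true - signalOne M.pH l := by
  have hl1 : l < 1 := by linarith
  have hr : ∀ s, 0 ≤ σ l s ∧ σ l s ≤ 1 := fun s => (hσ.low_optimal l hl0 hl1 s).1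
  obtain ⟨c, c0, hc1, hc⟩ := payoff_sub M hM (σ l) l true hl0 hl1 hr
  have t := (hσ.low_optimal l hl0 hl1 true).2 1 (by simp)
  -- Otherwise reporting `1` for sure would be a strict improvement, as `σ l true < 1`.
  have : payoff M (σ l) l true true - payoff M (σ l) l true false ≤ 0 := by
    by_contra! h
    nlinarith
  rw [hc, hσ.below l hl0 hl] at this
  simp only [if_true, mul_zero, add_zero] at this
  have hd : M.κ ≤ c * (signalOne M.pL l * σ l true - signalOne M.pH l) := by linarith
  have hd0 : 0 ≤ signalOne M.pL l * σ l true - signalOne M.pH l :=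
    nonneg_of_mul_nonneg_right (hM.cost_nonneg.trans hd) c0
  have hk : 0 ≤ M.ϖ * (1 - M.pH) ^ 2 := mul_nonneg hM.high_pos.le (sq_nonneg _)
  calc _ ≤ c * (signalOne M.pL l * σ l true - signalOne M.pH l) * (M.ϖ * (1 - M.pH) ^ 2) :=
        mul_le_mul_of_nonneg_right hd hk
    _ = c * (M.ϖ * (1 - M.pH) ^ 2) * (signalOne M.pL l * σ l true - signalOne M.pH l) := by ring
    _ ≤ _ := mul_le_of_le_one_left hd0 hc1

/-- Above `1/2`, a distorting low type reports `0` too often on average. -/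
lemma IsOneSidedEquilibrium.above_bound {M : Params} {σ : ℝ → Rule}
    (hσ : IsOneSidedEquilibrium M σ) (hM : M.Admissible) {l : ℝ} (hl : 1 / 2 < l) (hl1 : l < 1)
    (hlt : 0 < σ l false) :
    M.κ * (M.ϖ * (1 - M.pH) ^ 2) ≤
      signalOne M.pH l - (signalOne M.pL l + (1 - signalOne M.pL l) * σ l false) := by
  have hl0 : 0 < l := by linarith
  have hr : ∀ s, 0 ≤ σ l s ∧ σ l s ≤ 1 := fun s => (hσ.low_optimal l hl0 hl1 s).1
  obtain ⟨c, c0, hc1, hc⟩ := payoff_sub M hM (σ l) l false hl0 hl1 hr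
  have t := (hσ.low_optimal l hl0 hl1 false).2 0 (by simp)
  have : 0 ≤ payoff M (σ l) l false true - payoff M (σ l) l false false := by
    by_contra! h
    nlinarith
  rw [hc, hσ.above l hl hl1] at this
  simp only [Bool.false_eq_true, if_false, mul_one] at this
  set D := signalOne M.pH l - (signalOne M.pL l + (1 - signalOne M.pL l) * σ l false)
  have hd : M.κ ≤ c * D := by linarith
  have hd0 : 0 ≤ D := nonneg_of_mul_nonneg_right (hM.cost_nonneg.trans hd) c0
  have hk : 0 ≤ M.ϖ * (1 - M.pH) ^ 2 := mul_nonneg hM.high_pos.le (sq_nonneg _)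
  calc _ ≤ c * D * (M.ϖ * (1 - M.pH) ^ 2) := mul_le_mul_of_nonneg_right hd hk
    _ = c * (M.ϖ * (1 - M.pH) ^ 2) * D := by ring
    _ ≤ _ := mul_le_of_le_one_left hd0 hc1

/-- An equilibrium rule is truthful, or distorts one signal with marginals shifted accordingly. -/
lemma IsOneSidedEquilibrium.rule_cases {M : Params} {σ : ℝ → Rule}
    (hσ : IsOneSidedEquilibrium M σ) (hM : M.Admissible) {l : ℝ} (hl0 : 0 < l) (hl1 : l < 1) :
    (σ l true = 1 ∧ σ l false = 0) ∨
    (σ l false = 0 ∧ σ l true ≤ 1 ∧ M.κ * (M.ϖ * (1 - M.pH) ^ 2) ≤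
      signalOne M.pL l * σ l true - signalOne M.pH l) ∨
    (σ l true = 1 ∧ 0 ≤ σ l false ∧ M.κ * (M.ϖ * (1 - M.pH) ^ 2) ≤
      signalOne M.pH l - (signalOne M.pL l + (1 - signalOne M.pL l) * σ l false)) := by
  have hr : ∀ s, 0 ≤ σ l s ∧ σ l s ≤ 1 := fun s => (hσ.low_optimal l hl0 hl1 s).1
  rcases lt_trichotomy l (1 / 2) with h | h | h
  · rcases (hr true).2.lt_or_eq with h' | h'
    · exact Or.inr (Or.inl ⟨hσ.below l hl0 h, h'.le, hσ.below_bound hM hl0 h h'⟩)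
    · exact Or.inl ⟨h', hσ.below l hl0 h⟩
  · rw [h, hσ.half]; simp [truthful]
  · rcases (hr false).1.lt_or_eq with h' | h'
    · exact Or.inr (Or.inr ⟨hσ.above l h hl1, h'.le, hσ.above_bound hM h hl1 h'⟩)
    · exact Or.inl ⟨hσ.above l h hl1, h'.symm⟩

/-- Distortion is limited because it never carries the low type's marginal back past the high
type's, which stays in `[1 - pH, pH]`. Hence informative experts reveal something about the state at
every date, even when the types are not separated. -/
lemma IsOneSidedEquilibrium.rule_gap {M : Params} {σ : ℝ → Rule}
    (hσ : IsOneSidedEquilibrium M σ) (hM : M.Admissible) {l : ℝ} (hl0 : 0 < l) (hl1 : l < 1) :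
    1 - M.pH ≤ σ l true - σ l false := by
  have h3 := hM.half_le_low
  have h4 := hM.low_lt_high
  have h5 := hM.high_prec_lt_one
  have hk : 0 ≤ M.κ * (M.ϖ * (1 - M.pH) ^ 2) :=
    mul_nonneg hM.cost_nonneg (mul_nonneg hM.high_pos.le (sq_nonneg _))
  have hr : ∀ s, 0 ≤ σ l s ∧ σ l s ≤ 1 := fun s => (hσ.low_optimal l hl0 hl1 s).1
  have a0 : 1 - M.pH ≤ signalOne M.pH l := by simp only [signalOne]; nlinarith
  have a1 : signalOne M.pH l ≤ M.pH := by simp only [signalOne]; nlinarith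
  have b0 : 0 ≤ signalOne M.pL l := by simp only [signalOne]; nlinarith
  have b1 : signalOne M.pL l ≤ 1 := by simp only [signalOne]; nlinarith
  rcases hσ.rule_cases hM hl0 hl1 with ⟨h1, h2⟩ | ⟨h1, h2, h⟩ | ⟨h1, h2, h⟩
  · rw [h1, h2]; linarith
  · rw [h1]
    have := mul_le_of_le_one_left (hr true).1 b1
    linarith
  · rw [h1]
    have := mul_nonneg b0 (sub_nonneg.2 (hr false).2)
    linarith

/-- With a deviation cost, low-type reports are less dispersed than high-type reports. -/
lemma IsOneSidedEquilibrium.exists_separation {M : Params} {σ : ℝ → Rule}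
    (hσ : IsOneSidedEquilibrium M σ) (hM : M.Admissible) (hκ : 0 < M.κ) :
    ∃ c, 0 < c ∧ ∀ l, 0 < l → l < 1 →
      reportProb M.pL (σ l) true true + c ≤ M.pH ∧
        1 - M.pH + c ≤ reportProb M.pL (σ l) false true := by
  have h3 := hM.half_le_low
  have h4 := hM.low_lt_high
  have h5 := hM.high_prec_lt_one
  have hk : 0 < M.κ * (M.ϖ * (1 - M.pH) ^ 2) :=
    mul_pos hκ (mul_pos hM.high_pos (pow_pos (by linarith) 2))
  refine ⟨min (M.pH - M.pL) (M.κ * (M.ϖ * (1 - M.pH) ^ 2)), lt_min (by linarith) hk,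
    fun l hl0 hl1 => ?_⟩
  have m1 := min_le_left (M.pH - M.pL) (M.κ * (M.ϖ * (1 - M.pH) ^ 2))
  have m2 := min_le_right (M.pH - M.pL) (M.κ * (M.ϖ * (1 - M.pH) ^ 2))
  have hr : ∀ s, 0 ≤ σ l s ∧ σ l s ≤ 1 := fun s => (hσ.low_optimal l hl0 hl1 s).1
  simp only [reportProb_true, if_true, Bool.false_eq_true, if_false]
  rcases hσ.rule_cases hM hl0 hl1 with ⟨h1, h2⟩ | ⟨h1, h2, h⟩ | ⟨h1, h2, h⟩
  · rw [h1, h2]; constructor <;> linarith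
  · rw [h1]
    have : M.pL * σ l true ≤ M.pL := mul_le_of_le_one_right (by linarith) h2
    refine ⟨by linarith, ?_⟩
    -- The excess of the marginal is an average over the two states. The state-1 term is
    -- nonpositive, so state 0 accounts for all of it; its weight is at most 1, whence a bound free
    -- of `l`. Above `1/2` the roles of the states are exchanged.
    have e : signalOne M.pL l * σ l true - signalOne M.pH l =
        l * (M.pL * σ l true - M.pH) + (1 - l) * ((1 - M.pL) * σ l true - (1 - M.pH)) := by
      simp only [signalOne]; ring
    have : l * (M.pL * σ l true - M.pH) ≤ 0 :=
      mul_nonpos_of_nonneg_of_nonpos hl0.le (by linarith)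
    have h' : M.κ * (M.ϖ * (1 - M.pH) ^ 2) ≤
      (1 - l) * ((1 - M.pL) * σ l true - (1 - M.pH)) := by linarith
    have h0 := nonneg_of_mul_nonneg_right (hk.le.trans h') (by linarith)
    have := mul_le_of_le_one_left h0 (show 1 - l ≤ 1 by linarith)
    linarith
  · rw [h1]
    have : 0 ≤ M.pL * σ l false := mul_nonneg (by linarith) h2
    refine ⟨?_, by linarith⟩
    have e : signalOne M.pH l - (signalOne M.pL l + (1 - signalOne M.pL l) * σ l false) =
        l * (M.pH - (M.pL + (1 - M.pL) * σ l false)) +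
          (1 - l) * ((1 - M.pH) - ((1 - M.pL) + M.pL * σ l false)) := by
      simp only [signalOne]; ring
    have : (1 - l) * ((1 - M.pH) - ((1 - M.pL) + M.pL * σ l false)) ≤ 0 :=
      mul_nonpos_of_nonneg_of_nonpos (by linarith) (by linarith)
    have h' : M.κ * (M.ϖ * (1 - M.pH) ^ 2) ≤
      l * (M.pH - (M.pL + (1 - M.pL) * σ l false)) := by linarith
    have h0 := nonneg_of_mul_nonneg_right (hk.le.trans h') hl0
    have := mul_le_of_le_one_left h0 hl1.le
    linarith

/-! ### Uniform separation of report laws -/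

/-- Probability of the report `y` of an expert of the given type at date `t` and belief `l`, in
state `b`. -/
noncomputable def reportLaw (M : Params) (σ : ℝ → Rule) (t : ℕ) (l : ℝ) (b high y : Bool) : ℝ :=
  reportProb (M.prec high) (ruleAt M σ t l high) b y

lemma Params.Admissible.prec_mem {M : Params} (hM : M.Admissible) (v : Bool) :
    1 / 2 ≤ M.prec v ∧ M.prec v < 1 := by
  have h3 := hM.half_le_low
  have h4 := hM.low_lt_high
  have h5 := hM.high_prec_lt_one
  cases v <;> simp only [Params.prec] <;> norm_num <;> constructor <;> linarith

lemma sum_reportLaw (M : Params) (σ : ℝ → Rule) (t : ℕ) (l : ℝ) (b v : Bool) :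
    ∑ y, reportLaw M σ t l b v y = 1 := sum_reportProb _ _ _

section

variable {M : Params} {σ : ℝ → Rule} (hσ : IsOneSidedEquilibrium M σ) (hM : M.Admissible)

include hσ hM

lemma ruleAt_bounds (t : ℕ) {l : ℝ} (hl0 : 0 < l) (hl1 : l < 1) (v : Bool) :
    0 ≤ ruleAt M σ t l v false ∧ ruleAt M σ t l v true ≤ 1 ∧
      1 - M.pH ≤ ruleAt M σ t l v true - ruleAt M σ t l v false := by
  have h3 := hM.half_le_low
  have h4 := hM.low_lt_high
  have ht : 0 ≤ truthful false ∧ truthful true ≤ 1 ∧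
      1 - M.pH ≤ truthful true - truthful false := by
    simp [truthful]; linarith
  unfold ruleAt
  split_ifs
  · exact ht
  · exact ht
  · exact ⟨(hσ.low_optimal l hl0 hl1 false).1.1, (hσ.low_optimal l hl0 hl1 true).1.2,
      hσ.rule_gap hM hl0 hl1⟩

lemma reportLaw_pos (t : ℕ) {l : ℝ} (hl0 : 0 < l) (hl1 : l < 1) (b v y : Bool) :
    0 < reportLaw M σ t l b v y := by
  obtain ⟨h1, h2, h3⟩ := ruleAt_bounds hσ hM t hl0 hl1 v
  have := hM.prec_mem v
  have := hM.high_prec_lt_one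
  exact reportProb_pos (by linarith) (by linarith) h1 h2 (by linarith) _ _

lemma le_reportLaw_sub (t : ℕ) {l : ℝ} (hl0 : 0 < l) (hl1 : l < 1) (v : Bool) :
    (2 * M.prec v - 1) * (1 - M.pH) ≤
      reportLaw M σ t l true v true - reportLaw M σ t l false v true := by
  obtain ⟨-, -, h3⟩ := ruleAt_bounds hσ hM t hl0 hl1 v
  have := hM.prec_mem v
  rw [reportLaw, reportLaw, reportProb_sub]
  exact mul_le_mul_of_nonneg_left h3 (by linarith)

-- If `pL = 1/2`, the low type has no information and only the high type has to be bounded;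
-- otherwise the low type gives the smaller constant.
omit hσ in
lemma exists_informative_gap : ∃ k, 0 < k ∧ ∀ v, 1 / 2 < M.prec v →
    k ≤ (2 * M.prec v - 1) * (1 - M.pH) := by
  have h3 := hM.half_le_low
  have h4 := hM.low_lt_high
  have h5 := hM.high_prec_lt_one
  have hp : 0 < 1 - M.pH := by linarith
  rcases h3.lt_or_eq with h | h
  · refine ⟨(2 * M.pL - 1) * (1 - M.pH), mul_pos (by linarith) hp, fun v _ => ?_⟩
    refine mul_le_mul_of_nonneg_right ?_ hp.le
    cases v <;> simp [Params.prec]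
    linarith
  · refine ⟨(2 * M.pH - 1) * (1 - M.pH), mul_pos (by linarith) hp, fun v hv => ?_⟩
    cases v
    · simp [Params.prec] at hv; norm_num at h; linarith
    · simp [Params.prec]

/-- At evaluation dates, and at all dates if deviations are costly, reports separate the types of
an expert, and the states if the expert is informative. -/
lemma exists_reportLaw_separation : ∃ c, 0 < c ∧ ∀ t l, 0 < l → l < 1 → t ∈ M.E ∨ 0 < M.κ →
    ∀ b b' v v', v ≠ v' ∨ (b ≠ b' ∧ v = v' ∧ 1 / 2 < M.prec v) →
      c ≤ |reportLaw M σ t l b v true - reportLaw M σ t l b' v' true| := by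
  have h3 := hM.half_le_low
  have h4 := hM.low_lt_high
  obtain ⟨k, hk, hkv⟩ := exists_informative_gap hM
  obtain ⟨c, hc, hcl⟩ : ∃ c, 0 < c ∧ ∀ t l, 0 < l → l < 1 → t ∈ M.E ∨ 0 < M.κ →
      reportLaw M σ t l true false true + c ≤ M.pH ∧
        1 - M.pH + c ≤ reportLaw M σ t l false false true := by
    have htr : ∀ t l, t ∈ M.E → reportLaw M σ t l true false true + (M.pH - M.pL) ≤ M.pH ∧
        1 - M.pH + (M.pH - M.pL) ≤ reportLaw M σ t l false false true := by
      intro t l ht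
      simp [reportLaw, ruleAt, ht, reportProb_true, truthful, Params.prec]
    by_cases hκ : 0 < M.κ
    · obtain ⟨c, hc, h⟩ := hσ.exists_separation hM hκ
      refine ⟨min c (M.pH - M.pL), lt_min hc (by linarith), fun t l hl0 hl1 _ => ?_⟩
      have m1 := min_le_left c (M.pH - M.pL)
      have m2 := min_le_right c (M.pH - M.pL)
      by_cases ht : t ∈ M.E
      · have := htr t l ht
        constructor <;> linarith
      · have := h l hl0 hl1
        have e : ∀ b, reportLaw M σ t l b false true = reportProb M.pL (σ l) b true := by
          simp [reportLaw, ruleAt, ht, Params.prec]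
        rw [e, e]
        constructor <;> linarith
    · exact ⟨M.pH - M.pL, by linarith, fun t l _ _ h => htr t l (h.resolve_right hκ)⟩
  refine ⟨min c k, lt_min hc hk, fun t l hl0 hl1 ht b b' v v' h => ?_⟩
  have m1 := min_le_left c k
  have m2 := min_le_right c k
  obtain ⟨c1, c2⟩ := hcl t l hl0 hl1 ht
  -- The high type's probabilities of report `1` are the endpoints `1 - pH` and `pH`, while the low
  -- type's lie at least `c` inside them in both states. Types are thus separated even when the
  -- states compared also differ.
  have hH : ∀ b, reportLaw M σ t l b true true = if b then M.pH else 1 - M.pH := by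
    intro b
    simp [reportLaw, ruleAt, reportProb_true, truthful, Params.prec]
  have hL := le_reportLaw_sub hσ hM t hl0 hl1 false
  have hL' : 0 ≤ (2 * M.prec false - 1) * (1 - M.pH) :=
    mul_nonneg (by have := hM.prec_mem false; linarith) (by have := hM.high_prec_lt_one; linarith)
  rcases h with h | ⟨h, rfl, hv⟩
  · rw [le_abs]
    cases v <;> cases v' <;> simp only [ne_eq, not_true_eq_false] at h <;>
      cases b <;> cases b' <;> simp only [hH, if_true, Bool.false_eq_true, if_false] <;>
      first
      | (left; linarith)
      | (right; linarith)
  · have g := le_reportLaw_sub hσ hM t hl0 hl1 v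
    have := hkv v hv
    rw [le_abs]
    cases b <;> cases b' <;> simp only [ne_eq, not_true_eq_false] at h
    · right; linarith
    · left; linarith

end

/-! ### Report laws averaged over reputations -/

/-- Probability of the report `y` in state `b` of an expert with reputation `ρ`. -/
noncomputable def mixedLaw (M : Params) (σ : ℝ → Rule) (t : ℕ) (l ρ : ℝ) (b y : Bool) : ℝ :=
  ρ * reportLaw M σ t l b true y + (1 - ρ) * reportLaw M σ t l b false y

lemma likelihoodRatio_eq (M : Params) (σ : ℝ → Rule) (t : ℕ) (l ρ : ℝ) (y : Bool) :
    likelihoodRatio M σ t l ρ y = mixedLaw M σ t l ρ true y / mixedLaw M σ t l ρ false y := rfl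

lemma sum_mixedLaw (M : Params) (σ : ℝ → Rule) (t : ℕ) (l ρ : ℝ) (b : Bool) :
    ∑ y, mixedLaw M σ t l ρ b y = 1 := by
  simp only [mixedLaw, Finset.sum_add_distrib, ← Finset.mul_sum, sum_reportLaw]
  ring

lemma mixedLaw_pos {M : Params} {σ : ℝ → Rule} (hσ : IsOneSidedEquilibrium M σ)
    (hM : M.Admissible) (t : ℕ) {l ρ : ℝ} (hl0 : 0 < l) (hl1 : l < 1) (hρ0 : 0 ≤ ρ) (hρ1 : ρ ≤ 1)
    (b y : Bool) : 0 < mixedLaw M σ t l ρ b y := by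
  have h1 := reportLaw_pos hσ hM t hl0 hl1 b true y
  have h2 := reportLaw_pos hσ hM t hl0 hl1 b false y
  unfold mixedLaw
  rcases hρ0.lt_or_eq with h | rfl
  · have := mul_pos h h1
    have := mul_nonneg (sub_nonneg.2 hρ1) h2.le
    linarith
  · simpa using h2

/-- The square root of the likelihood ratio of the false to the true state has a small mean when
the reputation is close to the true type. -/
lemma sum_reportLaw_mul_sqrt_le {M : Params} {σ : ℝ → Rule} (hσ : IsOneSidedEquilibrium M σ)
    (hM : M.Admissible) (t : ℕ) {l ρ w k : ℝ} (hl0 : 0 < l) (hl1 : l < 1) (hρ0 : 0 ≤ ρ)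
    (hρ1 : ρ ≤ 1) (b v : Bool) (hw0 : 0 < w) (hw : w ≤ if v then ρ else 1 - ρ) (hk0 : 0 ≤ k)
    (hk : k ≤ (2 * M.prec v - 1) * (1 - M.pH)) :
    ∑ y, reportLaw M σ t l b v y * √(mixedLaw M σ t l ρ (!b) y / mixedLaw M σ t l ρ b y) ≤
      w⁻¹ * (1 - (w * k) ^ 2 / 4) := by
  have hpos := fun b v y => reportLaw_pos hσ hM t hl0 hl1 b v y
  have hm := fun b y => mixedLaw_pos hσ hM t hl0 hl1 hρ0 hρ1 b y
  -- The mixture contains the true law with weight at least `w`, so replacing the true law by the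
  -- mixture costs a factor `w⁻¹` and leaves a genuine Bhattacharyya coefficient.
  have hw' : ∀ y, w * reportLaw M σ t l b v y ≤ mixedLaw M σ t l ρ b y := by
    intro y
    have e1 := mul_nonneg hρ0 (hpos b true y).le
    have e2 := mul_nonneg (sub_nonneg.2 hρ1) (hpos b false y).le
    have e3 := mul_le_mul_of_nonneg_right hw (hpos b v y).le
    unfold mixedLaw
    cases v
    · simp only [Bool.false_eq_true, if_false] at e3; linarith
    · simp only [if_true] at e3; linarith
  have hterm : ∀ y, reportLaw M σ t l b v y *
      √(mixedLaw M σ t l ρ (!b) y / mixedLaw M σ t l ρ b y) ≤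
      w⁻¹ * √(mixedLaw M σ t l ρ b y * mixedLaw M σ t l ρ (!b) y) := by
    intro y
    have e : √(mixedLaw M σ t l ρ b y * mixedLaw M σ t l ρ (!b) y) =
        mixedLaw M σ t l ρ b y * √(mixedLaw M σ t l ρ (!b) y / mixedLaw M σ t l ρ b y) := by
      have : mixedLaw M σ t l ρ b y * mixedLaw M σ t l ρ (!b) y = mixedLaw M σ t l ρ b y ^ 2 *
          (mixedLaw M σ t l ρ (!b) y / mixedLaw M σ t l ρ b y) := by
        have := (hm b y).ne'
        field_simp
      rw [this, Real.sqrt_mul (sq_nonneg _), Real.sqrt_sq (hm b y).le]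
    rw [e, ← mul_assoc]
    refine mul_le_mul_of_nonneg_right ?_ (Real.sqrt_nonneg _)
    rw [inv_mul_eq_div, le_div_iff₀ hw0, mul_comm]
    exact hw' y
  refine (Finset.sum_le_sum fun y _ => hterm y).trans ?_
  rw [← Finset.mul_sum]
  refine mul_le_mul_of_nonneg_left ?_ (inv_nonneg.2 hw0.le)
  refine (sum_sqrt_mul_le (fun y => (hm b y).le) (fun y => (hm (!b) y).le)
    (sum_mixedLaw ..) (sum_mixedLaw ..)).trans ?_
  -- Both types have a nonnegative gap between the states, so the other type cannot cancel the
  -- contribution of the true one.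
  have hg : w * k ≤ mixedLaw M σ t l ρ true true - mixedLaw M σ t l ρ false true := by
    have g : ∀ v, 0 ≤ reportLaw M σ t l true v true - reportLaw M σ t l false v true := fun v =>
      le_trans (mul_nonneg (by have := hM.prec_mem v; linarith)
        (by have := hM.high_prec_lt_one; linarith)) (le_reportLaw_sub hσ hM t hl0 hl1 v)
    have gv := hk.trans (le_reportLaw_sub hσ hM t hl0 hl1 v)
    have e1 := mul_nonneg hρ0 (g true)
    have e2 := mul_nonneg (sub_nonneg.2 hρ1) (g false)
    have e3 := mul_le_mul hw gv hk0 (hw0.le.trans hw)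
    unfold mixedLaw
    cases v
    · simp only [Bool.false_eq_true, if_false] at e3; linarith
    · simp only [if_true] at e3; linarith
  have hs : (w * k) ^ 2 ≤ (mixedLaw M σ t l ρ b true - mixedLaw M σ t l ρ (!b) true) ^ 2 := by
    refine sq_le_sq.2 ?_
    rw [abs_of_nonneg (mul_nonneg hw0.le hk0), le_abs]
    cases b
    · right; simp only [Bool.not_false]; linarith
    · left; simpa using hg
  linarith

/-! ### Products along a process with finite alphabet -/

section Abstract

variable {A : Type*} [Inhabited A]

/-- A finite word, continued by the default letter. -/
def extend {T : ℕ} (h : Fin T → A) : ℕ → A := fun t => if ht : t < T then h ⟨t, ht⟩ else default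

lemma extend_apply {T : ℕ} (h : Fin T → A) {t : ℕ} (ht : t < T) : extend h t = h ⟨t, ht⟩ :=
  dif_pos ht

lemma sum_prod_univ {R ι κ : Type*} [CommSemiring R] [Fintype ι] [DecidableEq ι] [Fintype κ]
    (f : ι → κ → R) : ∑ x : ι → κ, ∏ i, f i (x i) = ∏ i, ∑ j, f i j := by
  rw [Finset.prod_univ_sum, Fintype.piFinset_univ]

/-- The tower property in finite form: the last letter is summed out with the past fixed. Since `f
t` depends only on the first `t` letters, the default letters added by `extend` have no effect. -/
lemma sum_prod_extend_le [Fintype A] {f : ℕ → (ℕ → A) → A → ℝ} {β : ℕ → ℝ}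
    (hf0 : ∀ t h a, 0 ≤ f t h a)
    (hf : ∀ t h h', (∀ u < t, h u = h' u) → f t h = f t h')
    (hβ : ∀ t h, ∑ a, f t h a ≤ β t) (T : ℕ) :
    ∑ h : Fin T → A, ∏ t ∈ Finset.range T, f t (extend h) (extend h t) ≤
      ∏ t ∈ Finset.range T, β t := by
  induction T with
  | zero => simp
  | succ T ih =>
    rw [← (Fin.snocEquiv fun _ : Fin (T + 1) => A).sum_comp, Fintype.sum_prod_type_right]
    have e : ∀ (h : Fin T → A) (a : A), ∀ u < T,
        extend (Fin.snocEquiv (fun _ : Fin (T + 1) => A) (a, h)) u = extend h u := by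
      intro h a u hu
      rw [extend_apply _ hu, extend_apply _ (hu.trans T.lt_succ_self)]
      exact Fin.snoc_castSucc (α := fun _ => A) a h ⟨u, hu⟩
    have e' : ∀ (h : Fin T → A) (a : A),
        extend (Fin.snocEquiv (fun _ : Fin (T + 1) => A) (a, h)) T = a := by
      intro h a
      rw [extend_apply _ T.lt_succ_self]
      exact Fin.snoc_last (α := fun _ => A) a h
    have step : ∀ (h : Fin T → A) (a : A), (∏ t ∈ Finset.range (T + 1),
        f t (extend (Fin.snocEquiv (fun _ : Fin (T + 1) => A) (a, h)))
          (extend (Fin.snocEquiv (fun _ : Fin (T + 1) => A) (a, h)) t)) =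
        (∏ t ∈ Finset.range T, f t (extend h) (extend h t)) * f T (extend h) a := by
      intro h a
      rw [Finset.prod_range_succ, e', hf T _ _ (e h a)]
      congr 1
      refine Finset.prod_congr rfl fun t ht => ?_
      have ht := Finset.mem_range.1 ht
      rw [e h a t ht, hf t _ _ fun u hu => e h a u (hu.trans ht)]
    simp_rw [step, ← Finset.mul_sum]
    rw [Finset.prod_range_succ]
    calc _ ≤ ∑ h : Fin T → A, (∏ t ∈ Finset.range T, f t (extend h) (extend h t)) * β T :=
          Finset.sum_le_sum fun h _ => mul_le_mul_of_nonneg_left (hβ T _)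
            (Finset.prod_nonneg fun t _ => hf0 _ _ _)
      _ = (∑ h : Fin T → A, ∏ t ∈ Finset.range T, f t (extend h) (extend h t)) * β T := by
          rw [Finset.sum_mul]
      _ ≤ _ := mul_le_mul_of_nonneg_right ih
          ((Finset.sum_nonneg fun a _ => hf0 T (fun _ => default) a).trans (hβ T _))

variable {Ω : Type*} [MeasurableSpace Ω] [Fintype A] [MeasurableSpace A]
  [MeasurableSingletonClass A]

/-- If, along a process with transition kernel `q` on the event `D`, the factors `g` have conditional
means at most `β`, and the products of the `β` are summable, then the products of the `g` vanish in
the limit. -/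
lemma ae_tendsto_prod_zero (P : Measure Ω) [IsFiniteMeasure P] {D : Set Ω} (hD : MeasurableSet D)
    {Y : ℕ → Ω → A} (hY : ∀ t, Measurable (Y t)) {q g : ℕ → (ℕ → A) → A → ℝ} {β : ℕ → ℝ} {c : ℝ}
    (hc : 0 ≤ c) (hq0 : ∀ t h a, 0 ≤ q t h a) (hg0 : ∀ t h a, 0 ≤ g t h a)
    (hq : ∀ t h h', (∀ u < t, h u = h' u) → q t h = q t h')
    (hg : ∀ t h h', (∀ u < t, h u = h' u) → g t h = g t h')
    (hlaw : ∀ T h, P.real (D ∩ {ω | ∀ t < T, Y t ω = h t}) =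
      c * ∏ t ∈ Finset.range T, q t h (h t))
    (hβ : ∀ t h, ∑ a, q t h a * g t h a ≤ β t)
    (hsum : Summable fun T => ∏ t ∈ Finset.range T, β t) :
    ∀ᵐ ω ∂P, ω ∈ D →
      Tendsto (fun T => ∏ t ∈ Finset.range T, g t (fun u => Y u ω) (Y t ω)) atTop (𝓝 0) := by
  rw [← ae_restrict_iff' hD]
  set F : (T : ℕ) → (Fin T → A) → ENNReal := fun T h =>
    ENNReal.ofReal (∏ t ∈ Finset.range T, g t (extend h) (extend h t)) with hF
  let Z : (T : ℕ) → Ω → Fin T → A := fun T ω t => Y t ω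
  have hZ : ∀ T, Measurable (Z T) := fun T => measurable_pi_lambda _ fun t => hY t
  have hFm : ∀ T, Measurable (F T) := fun T => measurable_of_countable _
  have hFZ : ∀ T ω, F T (Z T ω) =
      ENNReal.ofReal (∏ t ∈ Finset.range T, g t (fun u => Y u ω) (Y t ω)) := by
    intro T ω
    simp only [hF]
    congr 1
    refine Finset.prod_congr rfl fun t ht => ?_
    have ht := Finset.mem_range.1 ht
    rw [extend_apply _ ht, hg t (extend (Z T ω)) (fun u => Y u ω)
      fun u hu => extend_apply _ (hu.trans ht)]
  -- The product depends on the first `T` letters only, so its mean over `D` is a finite sum over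
  -- words, bounded by the tower property.
  have hint : ∀ T, ∫⁻ ω in D, F T (Z T ω) ∂P ≤
      ENNReal.ofReal (c * ∏ t ∈ Finset.range T, β t) := by
    intro T
    rw [← lintegral_map (hFm T) (hZ T), lintegral_fintype]
    have hm : ∀ h : Fin T → A, ((P.restrict D).map (Z T)) {h} =
        ENNReal.ofReal (c * ∏ t ∈ Finset.range T, q t (extend h) (extend h t)) := by
      intro h
      rw [Measure.map_apply (hZ T) (measurableSet_singleton h),
        Measure.restrict_apply (hZ T (measurableSet_singleton h)), ← hlaw, ofReal_measureReal]
      congr 1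
      ext ω
      simp only [Set.mem_inter_iff, Set.mem_preimage, Set.mem_singleton_iff, Set.mem_ofPred_eq]
      rw [and_comm]
      refine and_congr_right fun _ => ⟨fun hh t ht => ?_, fun hh => ?_⟩
      · rw [extend_apply _ ht, ← hh]
      · funext t
        have := hh t t.2
        rwa [extend_apply _ t.2] at this
    simp_rw [hm, hF]
    have hpq : ∀ h : Fin T → A, 0 ≤ ∏ t ∈ Finset.range T, q t (extend h) (extend h t) :=
      fun h => Finset.prod_nonneg fun t _ => hq0 _ _ _
    have hpg : ∀ h : Fin T → A, 0 ≤ ∏ t ∈ Finset.range T, g t (extend h) (extend h t) :=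
      fun h => Finset.prod_nonneg fun t _ => hg0 _ _ _
    simp_rw [← ENNReal.ofReal_mul (hpg _)]
    rw [← ENNReal.ofReal_sum_of_nonneg fun h _ => mul_nonneg (hpg h) (mul_nonneg hc (hpq h))]
    refine ENNReal.ofReal_le_ofReal ?_
    have := sum_prod_extend_le (f := fun t h a => q t h a * g t h a)
      (fun t h a => mul_nonneg (hq0 t h a) (hg0 t h a))
      (fun t h h' hh => by simp only [hq t h h' hh, hg t h h' hh]) hβ T
    refine le_trans (le_of_eq ?_) (mul_le_mul_of_nonneg_left this hc)
    rw [Finset.mul_sum]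
    refine Finset.sum_congr rfl fun h _ => ?_
    rw [Finset.prod_mul_distrib]
    ring
  have hβ0 : ∀ T, 0 ≤ ∏ t ∈ Finset.range T, β t := fun T => Finset.prod_nonneg fun t _ =>
    (Finset.sum_nonneg fun a _ => mul_nonneg (hq0 t (fun _ => default) a) (hg0 _ _ a)).trans
      (hβ t _)
  have hFZm : ∀ T, Measurable fun ω => F T (Z T ω) := fun T => (hFm T).comp (hZ T)
  -- By Tonelli the series of products has finite mean, so it converges almost surely on `D` and its
  -- terms vanish.
  have hfin : ∫⁻ ω in D, ∑' T, F T (Z T ω) ∂P ≠ ⊤ := by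
    rw [lintegral_tsum fun T => (hFZm T).aemeasurable]
    refine ne_top_of_le_ne_top ?_ (ENNReal.tsum_le_tsum hint)
    rw [← ENNReal.ofReal_tsum_of_nonneg (fun T => mul_nonneg hc (hβ0 T)) (hsum.mul_left c)]
    exact ENNReal.ofReal_ne_top
  filter_upwards [ae_lt_top (Measurable.tsum hFZm) hfin]
    with ω hω
  have h0 := ENNReal.tendsto_atTop_zero_of_tsum_ne_top hω.ne
  simp only [hFZ] at h0
  have := (ENNReal.tendsto_toReal ENNReal.zero_ne_top).comp h0
  refine (this.congr fun T => ?_)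
  simp only [Function.comp]
  rw [ENNReal.toReal_ofReal]
  exact Finset.prod_nonneg fun t _ => hg0 _ _ _

end Abstract

lemma sum_measureReal_inter {Ω β : Type*} [MeasurableSpace Ω] (P : Measure Ω) [IsFiniteMeasure P]
    [Fintype β] [MeasurableSpace β] [MeasurableSingletonClass β] {X : Ω → β} (hX : Measurable X)
    (D : Set Ω) (B : Finset β) :
    ∑ x ∈ B, P.real (X ⁻¹' {x} ∩ D) = P.real (X ⁻¹' B ∩ D) := by
  have h : ∀ S : Set Ω, MeasurableSet S → P.real (S ∩ D) = (P.restrict D).real S := fun S hS =>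
    (measureReal_restrict_apply hS).symm
  rw [h _ (hX B.measurableSet), ← sum_measureReal_preimage_singleton B
    fun x _ => hX (measurableSet_singleton x)]
  exact Finset.sum_congr rfl fun x _ => h _ (hX (measurableSet_singleton x))

/-! ### Joint law of reports and Bayes' rule -/

section Posterior

variable {Ω : Type*} [MeasurableSpace Ω] {N : ℕ}

/-- The state together with the types of the experts. -/
def hidden (θ : Ω → Bool) (τ : Fin N → Ω → Bool) (ω : Ω) : Bool × (Fin N → Bool) :=
  (θ ω, fun i => τ i ω)

/-- Prior probability of a state and a profile of types. -/
noncomputable def prior (M : Params) (x : Bool × (Fin N → Bool)) : ℝ :=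
  coin M.μ x.1 * ∏ i, coin M.ϖ (x.2 i)

/-- Conditional probability of the report profile `a` after the history `h` of `t` periods. -/
noncomputable def profileLaw (M : Params) (σ : ℝ → Rule) (P : Measure Ω) (θ : Ω → Bool)
    (y : ℕ → Fin N → Ω → Bool) (x : Bool × (Fin N → Bool)) (t : ℕ) (h : ℕ → Fin N → Bool)
    (a : Fin N → Bool) : ℝ :=
  ∏ i, reportLaw M σ (t + 1) (belief P θ y t h) x.1 (x.2 i) (a i)

omit [MeasurableSpace Ω] in
lemma historyEvent_congr (y : ℕ → Fin N → Ω → Bool) {T : ℕ} {h h' : ℕ → Fin N → Bool}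
    (hh : ∀ u < T, h u = h' u) : historyEvent y T h = historyEvent y T h' := by
  ext ω
  exact forall₂_congr fun t ht => by rw [hh t ht]

lemma belief_congr (P : Measure Ω) (θ : Ω → Bool) (y : ℕ → Fin N → Ω → Bool) {T : ℕ}
    {h h' : ℕ → Fin N → Bool} (hh : ∀ u < T, h u = h' u) :
    belief P θ y T h = belief P θ y T h' := by
  rw [belief, belief, historyEvent_congr y hh]

omit [MeasurableSpace Ω] in
lemma historyEvent_eq (y : ℕ → Fin N → Ω → Bool) (T : ℕ) (h : ℕ → Fin N → Bool) :
    historyEvent y T h = {ω | ∀ t < T, (fun i => y t i ω) = h t} := by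
  ext ω
  simp only [historyEvent, Set.mem_ofPred_eq, funext_iff]

variable {M : Params} {σ : ℝ → Rule} {P : Measure Ω} {θ : Ω → Bool}
  {τ : Fin N → Ω → Bool} {s y : ℕ → Fin N → Ω → Bool}

lemma IsPlay.measurable_hidden (hp : IsPlay M σ P θ τ s y) : Measurable (hidden θ τ) :=
  hp.measurable_state.prodMk (measurable_pi_lambda _ hp.measurable_type)

lemma IsPlay.measurableSet_historyEvent (hp : IsPlay M σ P θ τ s y) (T : ℕ)
    (h : ℕ → Fin N → Bool) : MeasurableSet (historyEvent y T h) := by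
  have : historyEvent y T h = ⋂ t, ⋂ (_ : t < T), ⋂ i, y t i ⁻¹' {h t i} := by
    ext ω; simp [historyEvent]
  rw [this]
  exact .iInter fun t => .iInter fun _ => .iInter fun i =>
    hp.measurable_report t i (measurableSet_singleton _)

variable [IsProbabilityMeasure P]

/-- The joint law of the state, the types and the reports. -/
lemma IsPlay.report_law (hp : IsPlay M σ P θ τ s y) (x : Bool × (Fin N → Bool)) (T : ℕ)
    (h : ℕ → Fin N → Bool) :
    P.real (hidden θ τ ⁻¹' {x} ∩ historyEvent y T h) =
      prior M x * ∏ t ∈ Finset.range T, profileLaw M σ P θ y x t h (h t) := by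
  have hS : Measurable fun ω => fun (t : Fin T) (i : Fin N) => s t i ω :=
    measurable_pi_lambda _ fun t => measurable_pi_lambda _ fun i => hp.measurable_signal t i
  have hsum := sum_measureReal_inter P hS (hidden θ τ ⁻¹' {x} ∩ historyEvent y T h) Finset.univ
  rw [Finset.coe_univ, Set.preimage_univ, Set.univ_inter] at hsum
  rw [← hsum]
  have hterm : ∀ z : Fin T → Fin N → Bool,
      P.real ((fun ω => fun (t : Fin T) (i : Fin N) => s t i ω) ⁻¹' {z} ∩
        (hidden θ τ ⁻¹' {x} ∩ historyEvent y T h)) =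
      prior M x * ∏ t : Fin T, ∏ i, (signalProb (M.prec (x.2 i)) x.1 (z t i) *
            coin (ruleAt M σ (t + 1) (belief P θ y t h) (x.2 i) (z t i)) (h t i)) := by
    intro z
    have := hp.law T x.1 x.2 (extend z) h
    rw [Finset.prod_range] at this
    simp only [extend_apply z (Fin.is_lt _), Fin.eta] at this
    rw [prior, ← this]
    congr 1
    ext ω
    simp only [Set.mem_inter_iff, Set.mem_preimage, Set.mem_singleton_iff, Set.mem_ofPred_eq,
      hidden, historyEvent, Prod.ext_iff, funext_iff]
    constructor
    · rintro ⟨h1, ⟨h2, h3⟩, h4⟩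
      refine ⟨h2, h3, fun t ht i => ⟨?_, h4 t ht i⟩⟩
      rw [extend_apply z ht]
      exact h1 ⟨t, ht⟩ i
    · rintro ⟨h2, h3, h4⟩
      refine ⟨fun t i => ?_, ⟨h2, h3⟩, fun t ht i => (h4 t ht i).2⟩
      have := (h4 t t.2 i).1
      rwa [extend_apply z t.2] at this
  simp_rw [hterm]
  rw [← Finset.mul_sum, Finset.prod_range]
  congr 1
  -- The beliefs entering the rules depend on the reports `h` alone, not on the signals summed out,
  -- so the sum factors over dates and then over experts.
  rw [sum_prod_univ (fun (t : Fin T) (a : Fin N → Bool) => ∏ i,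
    (signalProb (M.prec (x.2 i)) x.1 (a i) *
      coin (ruleAt M σ (t + 1) (belief P θ y t h) (x.2 i) (a i)) (h t i)))]
  refine Finset.prod_congr rfl fun t _ => ?_
  rw [sum_prod_univ (fun (i : Fin N) (a : Bool) => signalProb (M.prec (x.2 i)) x.1 a *
      coin (ruleAt M σ (t + 1) (belief P θ y t h) (x.2 i) a) (h t i))]
  rfl

lemma prior_pos (hM : M.Admissible) (x : Bool × (Fin N → Bool)) : 0 < prior M x := by
  have h : ∀ q : ℝ, 0 < q → q < 1 → ∀ b, 0 < coin q b := by
    intro q h0 h1 b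
    cases b <;> simp [coin, h0, h1]
  exact mul_pos (h _ hM.prior_pos hM.prior_lt_one _)
    (Finset.prod_pos fun i _ => h _ hM.high_pos hM.high_lt_one _)

/-- Bayes' rule for a set `B` of hidden states. -/
lemma IsPlay.posterior_eq (hp : IsPlay M σ P θ τ s y) (B : Finset (Bool × (Fin N → Bool)))
    (T : ℕ) (h : ℕ → Fin N → Bool) :
    (P[|historyEvent y T h]).real (hidden θ τ ⁻¹' B) =
      (∑ x ∈ B, P.real (hidden θ τ ⁻¹' {x} ∩ historyEvent y T h)) /
        ∑ x, P.real (hidden θ τ ⁻¹' {x} ∩ historyEvent y T h) := by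
  rw [sum_measureReal_inter P hp.measurable_hidden, sum_measureReal_inter P hp.measurable_hidden,
    Finset.coe_univ, Set.preimage_univ, Set.univ_inter, measureReal_def,
    cond_apply (hp.measurableSet_historyEvent T h), ENNReal.toReal_mul, ENNReal.toReal_inv,
    Set.inter_comm, div_eq_inv_mul]
  rfl

lemma belief_eq (P : Measure Ω) (θ : Ω → Bool) (τ : Fin N → Ω → Bool)
    (y : ℕ → Fin N → Ω → Bool) (T : ℕ) (h : ℕ → Fin N → Bool) :
    belief P θ y T h = (P[|historyEvent y T h]).real (hidden θ τ ⁻¹'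
      (Finset.univ.filter fun x : Bool × (Fin N → Bool) => x.1 = true : Finset _)) := by
  rw [belief]
  congr 1
  ext ω
  simp [hidden]

lemma reputation_eq (P : Measure Ω) (θ : Ω → Bool) (τ : Fin N → Ω → Bool)
    (y : ℕ → Fin N → Ω → Bool) (i : Fin N) (T : ℕ) (ω : Ω) :
    reputation P τ y i T ω = (P[|historyEvent y T fun t j => y t j ω]).real (hidden θ τ ⁻¹'
      (Finset.univ.filter fun x : Bool × (Fin N → Bool) => x.2 i = true : Finset _)) := by
  rw [reputation]
  congr 1
  ext ω
  simp [hidden]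

/-- The high type is always truthful, so a panel of high types produces every history with positive
probability in both states. This uses nothing about `σ`, and it has to come first: the equilibrium
conditions restrict `σ` only at beliefs strictly between 0 and 1. -/
lemma IsPlay.belief_mem (hp : IsPlay M σ P θ τ s y) (hM : M.Admissible) (T : ℕ)
    (h : ℕ → Fin N → Bool) : 0 < belief P θ y T h ∧ belief P θ y T h < 1 := by
  have hpos : ∀ b, 0 < P.real (hidden θ τ ⁻¹' {(b, fun _ => true)} ∩ historyEvent y T h) := by
    intro b
    rw [hp.report_law]
    refine mul_pos (prior_pos hM _) (Finset.prod_pos fun t _ => Finset.prod_pos fun i _ => ?_)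
    have := hM.prec_mem true
    refine reportProb_pos (by linarith) this.2 ?_ ?_ ?_ _ _ <;> simp [ruleAt, truthful]
  rw [belief_eq P θ τ, hp.posterior_eq]
  have hle : ∀ x, 0 ≤ P.real (hidden θ τ ⁻¹' {x} ∩ historyEvent y T h) :=
    fun x => measureReal_nonneg
  have h1 := Finset.single_le_sum (fun x _ => hle x)
    (Finset.mem_filter.2 ⟨Finset.mem_univ (true, fun _ : Fin N => true), rfl⟩ :
      _ ∈ Finset.univ.filter fun x : Bool × (Fin N → Bool) => x.1 = true)
  have h0 := Finset.single_le_sum (fun x _ => hle x)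
    (Finset.mem_filter.2 ⟨Finset.mem_univ (false, fun _ : Fin N => true), by simp⟩ :
      _ ∈ Finset.univ.filter fun x : Bool × (Fin N → Bool) => ¬ x.1 = true)
  rw [← Finset.sum_filter_add_sum_filter_not Finset.univ
    (fun x : Bool × (Fin N → Bool) => x.1 = true)
    fun x => P.real (hidden θ τ ⁻¹' {x} ∩ historyEvent y T h)]
  have h1 := (hpos true).trans_le h1
  have h0 := (hpos false).trans_le h0
  exact ⟨by positivity, by rw [div_lt_one (by positivity)]; linarith⟩

/-- If the likelihood of every other hidden state vanishes relative to that of `x`, posteriors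
concentrate on `x`. -/
lemma IsPlay.tendsto_posterior (hp : IsPlay M σ P θ τ s y) (x : Bool × (Fin N → Bool))
    (h : ℕ → Fin N → Bool) (hx : ∀ T, 0 < P.real (hidden θ τ ⁻¹' {x} ∩ historyEvent y T h))
    (hlim : ∀ x', x' ≠ x → Tendsto (fun T => P.real (hidden θ τ ⁻¹' {x'} ∩ historyEvent y T h) /
      P.real (hidden θ τ ⁻¹' {x} ∩ historyEvent y T h)) atTop (𝓝 0))
    (B : Finset (Bool × (Fin N → Bool))) :
    Tendsto (fun T => (P[|historyEvent y T h]).real (hidden θ τ ⁻¹' B)) atTop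
      (𝓝 (if x ∈ B then 1 else 0)) := by
  have hlim' : ∀ x', Tendsto (fun T => P.real (hidden θ τ ⁻¹' {x'} ∩ historyEvent y T h) /
      P.real (hidden θ τ ⁻¹' {x} ∩ historyEvent y T h)) atTop (𝓝 (if x' = x then 1 else 0)) := by
    intro x'
    split_ifs with he
    · subst he
      exact tendsto_const_nhds.congr fun T => (div_self (hx T).ne').symm
    · exact hlim x' he
  -- Numerator and denominator of Bayes' rule are both divided by the likelihood of `x`.
  have hB : ∀ B : Finset (Bool × (Fin N → Bool)), Tendsto (fun T =>
      (∑ x' ∈ B, P.real (hidden θ τ ⁻¹' {x'} ∩ historyEvent y T h)) /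
        P.real (hidden θ τ ⁻¹' {x} ∩ historyEvent y T h)) atTop
      (𝓝 (if x ∈ B then 1 else 0)) := by
    intro B
    have := tendsto_finsetSum B fun x' _ => hlim' x'
    rw [Finset.sum_ite_eq' B x] at this
    simpa only [Finset.sum_div] using this
  have := (hB B).div (hB Finset.univ) (by simp)
  simp only [Finset.mem_univ, if_true, div_one] at this
  refine this.congr fun T => ?_
  rw [hp.posterior_eq, Pi.div_apply, div_div_div_cancel_right₀ (hx T).ne']

end Posterior

/-! ### Frequency of separating dates and summable bounds -/

open Classical in
/-- The dates whose reports separate the types and the states have positive frequency. -/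
lemma exists_frequency {M : Params} (h : 0 < lowerDensity M.E ∨ 0 < M.κ) :
    ∃ G : ℕ → Prop, (∀ t, G t → t + 1 ∈ M.E ∨ 0 < M.κ) ∧ ∃ d : ℝ, 0 < d ∧ ∀ᶠ T : ℕ in atTop,
      d * T ≤ ((Finset.range T).filter G).card := by
  by_cases hκ : 0 < M.κ
  · exact ⟨fun _ => True, fun _ _ => Or.inr hκ, 1, one_pos, Eventually.of_forall fun T => by simp⟩
  have h := h.resolve_right hκ
  refine ⟨fun t => t + 1 ∈ M.E, fun _ => Or.inl, lowerDensity M.E / 2, half_pos h, ?_⟩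
  have hb : IsBoundedUnder (· ≥ ·) atTop
      fun n : ℕ => (((Finset.Icc 1 n).filter (· ∈ M.E)).card : ℝ) / n :=
    isBoundedUnder_of ⟨0, fun n => by positivity⟩
  filter_upwards [eventually_lt_of_lt_liminf (half_lt_self h) hb, eventually_gt_atTop 0]
    with T hT hT0
  rw [lt_div_iff₀ (by exact_mod_cast hT0)] at hT
  refine hT.le.trans ?_
  norm_cast
  -- Dates run over `1, …, T` in the density but indices over `0, …, T - 1` in the process, hence
  -- the shift.
  refine Finset.card_le_card_of_injOn (fun n => n - 1) ?_ ?_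
  · intro n hn
    simp only [Finset.coe_filter, Finset.mem_Icc, Set.mem_ofPred_eq, Finset.mem_range] at hn ⊢
    refine ⟨by omega, ?_⟩
    rw [Nat.sub_add_cancel hn.1.1]
    exact hn.2
  · intro m hm n hn hmn
    simp only [Finset.coe_filter, Finset.mem_Icc, Set.mem_ofPred_eq] at hm hn hmn
    omega

-- The product is `exp (-c)` to the number of dates in `G` before `T`, eventually at most `exp (-(c
-- * d) * T)`.
open Classical in
lemma summable_prod_exp {G : ℕ → Prop} {d c : ℝ} (hd : 0 < d) (hc : 0 < c)
    (h : ∀ᶠ T : ℕ in atTop, d * T ≤ ((Finset.range T).filter G).card) :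
    Summable fun T => ∏ t ∈ Finset.range T, if G t then Real.exp (-c) else 1 := by
  refine Summable.of_norm_bounded_eventually_nat
    (Real.summable_exp_nat_mul_iff.2 (show -(c * d) < 0 by linarith [mul_pos hc hd])) ?_
  filter_upwards [h] with T hT
  rw [Finset.prod_ite, Finset.prod_const_one, mul_one, Finset.prod_const, ← Real.exp_nat_mul,
    Real.norm_eq_abs, Real.abs_exp, Real.exp_le_exp]
  have := mul_le_mul_of_nonneg_right hT hc.le
  linarith

lemma summable_prod_tail {n : ℕ} {β : ℝ} (h0 : 0 ≤ β) (h1 : β < 1) :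
    Summable fun T => ∏ t ∈ Finset.range T, if t < n then 1 else β := by
  rw [← summable_nat_add_iff n]
  refine (summable_geometric_of_lt_one h0 h1).congr fun T => ?_
  rw [add_comm T n, Finset.prod_range_add, Finset.prod_eq_one, one_mul]
  · simp
  · intro t ht
    rw [if_pos (Finset.mem_range.1 ht)]

lemma mul_sqrt_div {a b : ℝ} (ha : 0 < a) : a * √(b / a) = √(a * b) := by
  rw [show a * b = a ^ 2 * (b / a) by field_simp, Real.sqrt_mul (sq_nonneg _), Real.sqrt_sq ha.le]

/-! ### Almost sure concentration and divergence -/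

section

variable {Ω : Type*} [MeasurableSpace Ω] {N : ℕ} {M : Params} {σ : ℝ → Rule} {P : Measure Ω}
  {θ : Ω → Bool} {τ : Fin N → Ω → Bool} {s y : ℕ → Fin N → Ω → Bool}

lemma profileLaw_congr (M : Params) (σ : ℝ → Rule) (P : Measure Ω) (θ : Ω → Bool)
    (y : ℕ → Fin N → Ω → Bool) (x : Bool × (Fin N → Bool)) (t : ℕ) (h h' : ℕ → Fin N → Bool)
    (hh : ∀ u < t, h u = h' u) :
    profileLaw M σ P θ y x t h = profileLaw M σ P θ y x t h' := by
  funext a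
  rw [profileLaw, profileLaw, belief_congr P θ y hh]

variable [IsProbabilityMeasure P] (hp : IsPlay M σ P θ τ s y)
  (hσ : IsOneSidedEquilibrium M σ) (hM : M.Admissible)

include hp hσ hM

lemma profileLaw_pos (x : Bool × (Fin N → Bool)) (t : ℕ) (h : ℕ → Fin N → Bool)
    (a : Fin N → Bool) : 0 < profileLaw M σ P θ y x t h a :=
  Finset.prod_pos fun _ _ => reportLaw_pos hσ hM _ (hp.belief_mem hM t h).1
    (hp.belief_mem hM t h).2 _ _ _

lemma joint_pos (x : Bool × (Fin N → Bool)) (T : ℕ) (h : ℕ → Fin N → Bool) :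
    0 < P.real (hidden θ τ ⁻¹' {x} ∩ historyEvent y T h) := by
  rw [hp.report_law]
  exact mul_pos (prior_pos hM x) (Finset.prod_pos fun t _ => profileLaw_pos hp hσ hM x t h _)

/-- The Bhattacharyya coefficient of the report profiles in two hidden states. -/
lemma sum_profileLaw_mul_le (x x' : Bool × (Fin N → Bool)) (t : ℕ) (h : ℕ → Fin N → Bool)
    (i : Fin N) {c : ℝ} (hc0 : 0 ≤ c)
    (hc : c ≤ |reportLaw M σ (t + 1) (belief P θ y t h) x.1 (x.2 i) true -
      reportLaw M σ (t + 1) (belief P θ y t h) x'.1 (x'.2 i) true|) :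
    ∑ a, profileLaw M σ P θ y x t h a *
      √(profileLaw M σ P θ y x' t h a / profileLaw M σ P θ y x t h a) ≤
        Real.exp (-(c ^ 2 / 4)) := by
  obtain ⟨hl0, hl1⟩ := hp.belief_mem hM t h
  set l := belief P θ y t h with hl
  have hpos := fun b v z => reportLaw_pos hσ hM (t + 1) hl0 hl1 b v z
  have e : ∀ a, profileLaw M σ P θ y x t h a *
      √(profileLaw M σ P θ y x' t h a / profileLaw M σ P θ y x t h a) =
      ∏ j, √(reportLaw M σ (t + 1) l x.1 (x.2 j) (a j) *
        reportLaw M σ (t + 1) l x'.1 (x'.2 j) (a j)) := by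
    intro a
    rw [mul_sqrt_div (profileLaw_pos hp hσ hM x t h a), profileLaw, profileLaw,
      ← Finset.prod_mul_distrib, Real.sqrt_prod _ fun j _ => (mul_pos (hpos _ _ _) (hpos _ _ _)).le]
  simp_rw [e]
  rw [sum_prod_univ (fun j z => √(reportLaw M σ (t + 1) l x.1 (x.2 j) z *
        reportLaw M σ (t + 1) l x'.1 (x'.2 j) z))]
  have hb : ∀ j, ∑ z, √(reportLaw M σ (t + 1) l x.1 (x.2 j) z *
        reportLaw M σ (t + 1) l x'.1 (x'.2 j) z) ≤
      1 - (reportLaw M σ (t + 1) l x.1 (x.2 j) true -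
        reportLaw M σ (t + 1) l x'.1 (x'.2 j) true) ^ 2 / 4 := fun j =>
    sum_sqrt_mul_le (fun z => (hpos _ _ z).le) (fun z => (hpos _ _ z).le) (sum_reportLaw ..)
      (sum_reportLaw ..)
  have h0 : ∀ j, 0 ≤ ∑ z, √(reportLaw M σ (t + 1) l x.1 (x.2 j) z *
        reportLaw M σ (t + 1) l x'.1 (x'.2 j) z) := fun j =>
    Finset.sum_nonneg fun z _ => Real.sqrt_nonneg _
  -- One separating expert suffices: the coefficients of all others are at most 1.
  rw [← Finset.mul_prod_erase _ _ (Finset.mem_univ i)]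
  calc _ ≤ ∑ z, √(reportLaw M σ (t + 1) l x.1 (x.2 i) z *
        reportLaw M σ (t + 1) l x'.1 (x'.2 i) z) := by
        refine mul_le_of_le_one_right (h0 i) (Finset.prod_le_one (fun j _ => h0 j) fun j _ => ?_)
        refine (hb j).trans ?_
        linarith [sq_nonneg (reportLaw M σ (t + 1) l x.1 (x.2 j) true -
          reportLaw M σ (t + 1) l x'.1 (x'.2 j) true)]
    _ ≤ 1 - c ^ 2 / 4 := by
        refine (hb i).trans ?_
        have := pow_le_pow_left₀ hc0 hc 2
        rw [sq_abs] at this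
        linarith
    _ ≤ _ := by
        have := Real.add_one_le_exp (-(c ^ 2 / 4))
        linarith

/-- If some expert is informative, the likelihood of every other hidden state vanishes relative to
the true one. -/
lemma ae_tendsto_joint_div (hdesign : 0 < lowerDensity M.E ∨ 0 < M.κ)
    {x x' : Bool × (Fin N → Bool)} (hx : ∃ i, 1 / 2 < M.prec (x.2 i)) (hne : x' ≠ x) :
    ∀ᵐ ω ∂P, ω ∈ hidden θ τ ⁻¹' {x} →
      Tendsto (fun T => P.real (hidden θ τ ⁻¹' {x'} ∩ historyEvent y T fun t j => y t j ω) /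
        P.real (hidden θ τ ⁻¹' {x} ∩ historyEvent y T fun t j => y t j ω)) atTop (𝓝 0) := by
  classical
  obtain ⟨G, hG, d, hd, hfreq⟩ := exists_frequency hdesign
  obtain ⟨c, hc, hsep⟩ := exists_reportLaw_separation hσ hM
  -- If the type profiles differ, an expert with differing types separates the hidden states; if
  -- they agree, the states differ and an informative expert does.
  obtain ⟨i, hi⟩ : ∃ i, x.2 i ≠ x'.2 i ∨ (x.1 ≠ x'.1 ∧ x.2 i = x'.2 i ∧ 1 / 2 < M.prec (x.2 i)) := by
    by_cases hv : x.2 = x'.2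
    · obtain ⟨i, hi⟩ := hx
      refine ⟨i, Or.inr ⟨fun hb => hne (Prod.ext hb.symm hv.symm), congrFun hv i, hi⟩⟩
    · obtain ⟨i, hi⟩ := Function.ne_iff.1 hv
      exact ⟨i, Or.inl hi⟩
  have hpos := profileLaw_pos hp hσ hM
  have key := ae_tendsto_prod_zero P (D := hidden θ τ ⁻¹' {x})
    (hp.measurable_hidden (measurableSet_singleton x)) (Y := fun t ω i => y t i ω)
    (fun t => measurable_pi_lambda _ fun i => hp.measurable_report t i)
    (q := profileLaw M σ P θ y x)
    (g := fun t h a => √(profileLaw M σ P θ y x' t h a / profileLaw M σ P θ y x t h a))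
    (β := fun t => if G t then Real.exp (-(c ^ 2 / 4)) else 1)
    (prior_pos hM x).le (fun t h a => (hpos x t h a).le) (fun t h a => Real.sqrt_nonneg _)
    (profileLaw_congr M σ P θ y x)
    (fun t h h' hh => by
      simp only [profileLaw_congr M σ P θ y x t h h' hh, profileLaw_congr M σ P θ y x' t h h' hh])
    (fun T h => by rw [← historyEvent_eq, hp.report_law])
    (fun t h => by
      obtain ⟨hl0, hl1⟩ := hp.belief_mem hM t h
      split_ifs with ht
      · exact sum_profileLaw_mul_le hp hσ hM x x' t h i hc.le
          (hsep (t + 1) _ hl0 hl1 (hG t ht) x.1 x'.1 _ _ hi)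
      -- With separation 0, the bound at the remaining dates is `exp 0 = 1`.
      · simpa using sum_profileLaw_mul_le hp hσ hM x x' t h i le_rfl (abs_nonneg _))
    (summable_prod_exp hd (by positivity) hfreq)
  filter_upwards [key] with ω hω hD
  have h2 := ((hω hD).pow 2).const_mul (prior M x' / prior M x)
  rw [zero_pow two_ne_zero, mul_zero] at h2
  refine h2.congr fun T => ?_
  rw [hp.report_law, hp.report_law, mul_div_mul_comm, ← Finset.prod_pow, ← Finset.prod_div_distrib]
  congr 1
  refine Finset.prod_congr rfl fun t _ => ?_
  rw [Real.sq_sqrt (div_pos (hpos _ _ _ _) (hpos _ _ _ _)).le]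

/-- Posteriors concentrate on the truth if some expert is informative. -/
lemma ae_tendsto_posterior (hdesign : 0 < lowerDensity M.E ∨ 0 < M.κ)
    {x : Bool × (Fin N → Bool)} (hx : ∃ i, 1 / 2 < M.prec (x.2 i)) :
    ∀ᵐ ω ∂P, ω ∈ hidden θ τ ⁻¹' {x} → ∀ B : Finset (Bool × (Fin N → Bool)),
      Tendsto (fun T => (P[|historyEvent y T fun t j => y t j ω]).real (hidden θ τ ⁻¹' B)) atTop
        (𝓝 (if x ∈ B then 1 else 0)) := by
  have := ae_all_iff.2 fun x' => ae_all_iff.2 fun hne : x' ≠ x =>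
    ae_tendsto_joint_div hp hσ hM hdesign hx hne
  filter_upwards [this] with ω hω hD B
  exact hp.tendsto_posterior x _ (fun T => joint_pos hp hσ hM x T _)
    (fun x' hne => hω x' hne hD) B

omit hp hσ hM [IsProbabilityMeasure P] in
/-- A weight on the true type that makes the likelihood ratio drift towards the true state. -/
lemma exists_weight (N : ℕ) {k : ℝ} (hk : 0 < k) : ∃ w : ℝ, 0 < w ∧ w < 1 ∧ ∃ β : ℝ,
    0 ≤ β ∧ β < 1 ∧ w⁻¹ ^ N * (1 - (w * k) ^ 2 / 4) ≤ β := by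
  -- At `w = 1` the expression equals `1 - k ^ 2 / 4 < 1`, so by continuity some `w < 1` works; the
  -- maximum with 0 only makes `β` nonnegative.
  have hcont : ContinuousAt (fun w : ℝ => w⁻¹ ^ N * (1 - (w * k) ^ 2 / 4)) 1 := by
    fun_prop (disch := norm_num)
  have h1 : ∀ᶠ w : ℝ in 𝓝[<] 1, w⁻¹ ^ N * (1 - (w * k) ^ 2 / 4) < 1 := by
    refine (hcont.tendsto.mono_left nhdsWithin_le_nhds).eventually_lt_const ?_
    have : 0 < k ^ 2 := by positivity
    simp only [inv_one, one_pow, one_mul]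
    linarith
  have h2 : ∀ᶠ w : ℝ in 𝓝[<] 1, 0 < w :=
    (lt_mem_nhds one_pos).filter_mono nhdsWithin_le_nhds
  have h3 : ∀ᶠ w : ℝ in 𝓝[<] 1, w < 1 := self_mem_nhdsWithin
  obtain ⟨w, hw, hw0, hw1⟩ := (h1.and (h2.and h3)).exists
  exact ⟨w, hw0, hw1, max (w⁻¹ ^ N * (1 - (w * k) ^ 2 / 4)) 0, le_max_right _ _,
    max_lt hw one_pos, le_max_left _ _⟩

/-- The square root of the likelihood ratio of the false to the true state, computed with
reputations, vanishes in the limit. -/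
lemma ae_tendsto_prod_mixedLaw (hdesign : 0 < lowerDensity M.E ∨ 0 < M.κ)
    {x : Bool × (Fin N → Bool)} (hx : ∃ i, 1 / 2 < M.prec (x.2 i)) :
    ∀ᵐ ω ∂P, ω ∈ hidden θ τ ⁻¹' {x} →
      Tendsto (fun T => ∏ t ∈ Finset.range T, ∏ i,
        √(mixedLaw M σ (t + 1) (publicBelief P θ y t ω) (reputation P τ y i t ω) (!x.1) (y t i ω) /
          mixedLaw M σ (t + 1) (publicBelief P θ y t ω) (reputation P τ y i t ω) x.1 (y t i ω)))
        atTop (𝓝 0) := by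
  classical
  obtain ⟨k, hk, hkv⟩ := exists_informative_gap hM
  obtain ⟨w, hw0, hw1, β, hβ0, hβ1, hwβ⟩ := exists_weight N hk
  obtain ⟨i₀, hi₀⟩ := hx
  let ρ : ℕ → (ℕ → Fin N → Bool) → Fin N → ℝ := fun t h i =>
    (P[|historyEvent y t h]).real {ω | τ i ω = true}
  have hρ0 : ∀ t h i, 0 ≤ ρ t h i := fun t h i => measureReal_nonneg
  have hρ1 : ∀ t h i, ρ t h i ≤ 1 := by
    intro t h i
    have hne : P (historyEvent y t h) ≠ 0 := by
      intro h0
      have h1 := joint_pos hp hσ hM x t h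
      rw [measureReal_def, measure_mono_null Set.inter_subset_right h0] at h1
      simp at h1
    have := cond_isProbabilityMeasure hne
    exact measureReal_le_one
  let near : ℕ → (ℕ → Fin N → Bool) → Prop := fun t h =>
    ∀ i, w ≤ if x.2 i then ρ t h i else 1 - ρ t h i
  let G : ℕ → (ℕ → Fin N → Bool) → (Fin N → Bool) → ℝ := fun t h a => ∏ i,
    √(mixedLaw M σ (t + 1) (belief P θ y t h) (ρ t h i) (!x.1) (a i) /
      mixedLaw M σ (t + 1) (belief P θ y t h) (ρ t h i) x.1 (a i))
  have hG0 : ∀ t h a, 0 ≤ G t h a := fun t h a =>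
    Finset.prod_nonneg fun i _ => Real.sqrt_nonneg _
  have hρc : ∀ t h h', (∀ u < t, h u = h' u) → ρ t h = ρ t h' := by
    intro t h h' hh
    funext i
    simp only [ρ, historyEvent_congr y hh]
  have hG : ∀ t h, near t h → ∑ a, profileLaw M σ P θ y x t h a * G t h a ≤ β := by
    intro t h hn
    obtain ⟨hl0, hl1⟩ := hp.belief_mem hM t h
    simp only [profileLaw, G, ← Finset.prod_mul_distrib]
    rw [sum_prod_univ (fun i z => reportLaw M σ (t + 1) (belief P θ y t h) x.1 (x.2 i) z *
      √(mixedLaw M σ (t + 1) (belief P θ y t h) (ρ t h i) (!x.1) z /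
        mixedLaw M σ (t + 1) (belief P θ y t h) (ρ t h i) x.1 z))]
    refine le_trans ?_ hwβ
    have hterm : ∀ i, ∑ z, reportLaw M σ (t + 1) (belief P θ y t h) x.1 (x.2 i) z *
        √(mixedLaw M σ (t + 1) (belief P θ y t h) (ρ t h i) (!x.1) z /
          mixedLaw M σ (t + 1) (belief P θ y t h) (ρ t h i) x.1 z) ≤
        w⁻¹ * if i = i₀ then 1 - (w * k) ^ 2 / 4 else 1 := by
      intro i
      split_ifs with hi
      · subst hi
        exact sum_reportLaw_mul_sqrt_le hσ hM (t + 1) hl0 hl1 (hρ0 t h i) (hρ1 t h i) x.1 (x.2 i)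
          hw0 (hn i) hk.le (hkv _ hi₀)
      -- The other experts may be uninformative; with gap 0 they contribute only the factor `w⁻¹`.
      · have := sum_reportLaw_mul_sqrt_le hσ hM (t + 1) hl0 hl1 (hρ0 t h i) (hρ1 t h i) x.1
          (x.2 i) hw0 (hn i) le_rfl
          (mul_nonneg (by have := hM.prec_mem (x.2 i); linarith)
            (by have := hM.high_prec_lt_one; linarith))
        simpa using this
    refine (Finset.prod_le_prod (fun i _ => Finset.sum_nonneg fun z _ =>
      mul_nonneg (reportLaw_pos hσ hM _ hl0 hl1 _ _ _).le (Real.sqrt_nonneg _))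
      fun i _ => hterm i).trans (le_of_eq ?_)
    rw [Finset.prod_mul_distrib, Finset.prod_const, Finset.card_univ, Fintype.card_fin,
      Finset.prod_ite_eq' Finset.univ i₀]
    simp
  have hpos := profileLaw_pos hp hσ hM
  -- The one-step bound holds only where reputations are near the truth, and the date from which
  -- this persists is random. The factors are therefore replaced by 1 before `n` and by 0 where
  -- reputations are not near; the result is used for all `n` simultaneously.
  have key := ae_all_iff.2 fun n : ℕ => ae_tendsto_prod_zero P (D := hidden θ τ ⁻¹' {x})
    (hp.measurable_hidden (measurableSet_singleton x)) (Y := fun t ω i => y t i ω)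
    (fun t => measurable_pi_lambda _ fun i => hp.measurable_report t i)
    (q := profileLaw M σ P θ y x)
    (g := fun t h a => if t < n then 1 else if near t h then G t h a else 0)
    (β := fun t => if t < n then 1 else β)
    (prior_pos hM x).le (fun t h a => (hpos x t h a).le)
    (fun t h a => by
      split_ifs
      exacts [zero_le_one, hG0 t h a, le_rfl])
    (profileLaw_congr M σ P θ y x)
    (fun t h h' hh => by
      simp only [near, G, hρc t h h' hh, belief_congr P θ y hh])
    (fun T h => by rw [← historyEvent_eq, hp.report_law])
    (fun t h => by
      split_ifs with h1 h2
      · simp only [mul_one, profileLaw]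
        rw [sum_prod_univ (fun i z => reportLaw M σ (t + 1) (belief P θ y t h) x.1 (x.2 i) z)]
        exact (Finset.prod_eq_one fun i _ => sum_reportLaw ..).le
      · exact hG t h h2
      · simpa using hβ0)
    (summable_prod_tail hβ0 hβ1)
  filter_upwards [key, ae_tendsto_posterior hp hσ hM hdesign ⟨i₀, hi₀⟩] with ω hω hpost hD
  have hnear : ∀ᶠ t in atTop, near t fun u j => y u j ω := by
    refine eventually_all.2 fun i => ?_
    have ht := hpost hD (Finset.univ.filter fun x : Bool × (Fin N → Bool) => x.2 i = true)
    simp_rw [← reputation_eq] at ht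
    simp only [Finset.mem_filter, Finset.mem_univ, true_and] at ht
    change ∀ᶠ t in atTop, w ≤ if x.2 i then reputation P τ y i t ω else 1 - reputation P τ y i t ω
    cases hxi : x.2 i
    · simp only [hxi, Bool.false_eq_true, if_false] at ht ⊢
      filter_upwards [ht.eventually_lt_const (sub_pos.2 hw1)] with t h
      linarith
    · simp only [hxi, if_true] at ht ⊢
      filter_upwards [ht.eventually_const_lt hw1] with t h using h.le
  obtain ⟨n, hn⟩ := eventually_atTop.1 hnear
  -- From `n` on the truncated factors are the original ones, so the two products differ by a
  -- constant factor, the product of the first `n` terms.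
  have hlim := (hω n hD).const_mul
    (∏ t ∈ Finset.range n, G t (fun u j => y u j ω) fun j => y t j ω)
  rw [mul_zero] at hlim
  refine hlim.congr' ?_
  filter_upwards [eventually_ge_atTop n] with T hT
  obtain ⟨m, rfl⟩ := Nat.exists_eq_add_of_le hT
  have e1 : ∏ t ∈ Finset.range n, (if t < n then 1 else if near t (fun u j => y u j ω) then
      G t (fun u j => y u j ω) (fun j => y t j ω) else 0) = 1 :=
    Finset.prod_eq_one fun t ht => if_pos (Finset.mem_range.1 ht)
  rw [Finset.prod_range_add, e1, one_mul, Finset.prod_range_add]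
  congr 1
  refine Finset.prod_congr rfl fun t _ => ?_
  rw [if_neg (by omega), if_pos (hn _ (Nat.le_add_right _ _))]
  rfl

lemma IsPlay.reputation_mem (t : ℕ) (i : Fin N) (ω : Ω) :
    0 ≤ reputation P τ y i t ω ∧ reputation P τ y i t ω ≤ 1 := by
  have hne : P (historyEvent y t fun u j => y u j ω) ≠ 0 := by
    intro h0
    have h1 := joint_pos hp hσ hM (true, fun _ => true) t fun u j => y u j ω
    rw [measureReal_def, measure_mono_null Set.inter_subset_right h0] at h1
    simp at h1
  have := cond_isProbabilityMeasure hne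
  exact ⟨measureReal_nonneg, measureReal_le_one⟩

/-- The cumulative log-likelihood diverges in the direction of the true state. -/
lemma ae_tendsto_cumLogLikelihood (hdesign : 0 < lowerDensity M.E ∨ 0 < M.κ)
    {x : Bool × (Fin N → Bool)} (hx : ∃ i, 1 / 2 < M.prec (x.2 i)) :
    ∀ᵐ ω ∂P, ω ∈ hidden θ τ ⁻¹' {x} →
      Tendsto (fun T => cumLogLikelihood M σ P θ τ y T ω) atTop
        (if x.1 = true then atTop else atBot) := by
  filter_upwards [ae_tendsto_prod_mixedLaw hp hσ hM hdesign hx] with ω hω hD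
  have hm : ∀ t i b z, 0 < mixedLaw M σ (t + 1) (publicBelief P θ y t ω)
      (reputation P τ y i t ω) b z := by
    intro t i b z
    obtain ⟨hl0, hl1⟩ := hp.belief_mem hM t fun u j => y u j ω
    obtain ⟨hρ0, hρ1⟩ := hp.reputation_mem hσ hM t i ω
    exact mixedLaw_pos hσ hM (t + 1) hl0 hl1 hρ0 hρ1 b z
  have hs := fun t i b b' => Real.sqrt_pos.2
    (div_pos (hm t i b (y t i ω)) (hm t i b' (y t i ω)))
  have h0 := tendsto_nhdsWithin_iff.2 ⟨hω hD, Eventually.of_forall fun T =>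
    Set.mem_Ioi.2 (Finset.prod_pos fun t _ => Finset.prod_pos fun i _ => hs t i (!x.1) x.1)⟩
  have hlog := Real.tendsto_log_nhdsGT_zero.comp h0
  -- The square root halves the logarithm, hence the 2; the ratio is that of the false to the true
  -- state, hence the sign change when the true state is 1.
  have e : ∀ T, cumLogLikelihood M σ P θ τ y T ω = (if x.1 = true then -2 else 2) *
      Real.log (∏ t ∈ Finset.range T, ∏ i,
        √(mixedLaw M σ (t + 1) (publicBelief P θ y t ω) (reputation P τ y i t ω) (!x.1) (y t i ω) /
          mixedLaw M σ (t + 1) (publicBelief P θ y t ω) (reputation P τ y i t ω) x.1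
            (y t i ω))) := by
    intro T
    rw [Real.log_prod fun t _ => (Finset.prod_pos fun i _ => hs t i (!x.1) x.1).ne',
      cumLogLikelihood, Finset.mul_sum]
    refine Finset.sum_congr rfl fun t _ => ?_
    rw [Real.log_prod fun i _ => (hs t i (!x.1) x.1).ne', Finset.mul_sum]
    refine Finset.sum_congr rfl fun i _ => ?_
    rw [Real.log_sqrt (div_pos (hm _ _ _ _) (hm _ _ _ _)).le, likelihoodRatio_eq,
      Real.log_div (hm _ _ _ _).ne' (hm _ _ _ _).ne', Real.log_div (hm _ _ _ _).ne' (hm _ _ _ _).ne']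
    cases x.1 <;> simp <;> ring
  simp_rw [e]
  cases hb : x.1
  · simp only [Bool.false_eq_true, if_false]
    rw [hb] at hlog
    exact hlog.const_mul_atBot two_pos
  · simp only [if_true]
    rw [hb] at hlog
    exact hlog.const_mul_atBot_of_neg (by norm_num)

end

/-! ### Log-odds and conclusion -/

lemma tendsto_logit_atTop {u : ℕ → ℝ} (h : ∀ T, 0 < u T ∧ u T < 1) (hu : Tendsto u atTop (𝓝 1)) :
    Tendsto (fun T => logit (u T)) atTop atTop := by
  refine Real.tendsto_log_atTop.comp ?_
  have h1 : Tendsto (fun T => 1 - u T) atTop (𝓝[>] 0) := by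
    refine tendsto_nhdsWithin_iff.2 ⟨?_, Eventually.of_forall fun T => sub_pos.2 (h T).2⟩
    simpa using hu.const_sub 1
  exact hu.pos_mul_atTop one_pos (tendsto_inv_nhdsGT_zero.comp h1)

lemma tendsto_logit_atBot {u : ℕ → ℝ} (h : ∀ T, 0 < u T ∧ u T < 1) (hu : Tendsto u atTop (𝓝 0)) :
    Tendsto (fun T => logit (u T)) atTop atBot := by
  refine Real.tendsto_log_nhdsGT_zero.comp (tendsto_nhdsWithin_iff.2
    ⟨?_, Eventually.of_forall fun T => div_pos (h T).1 (sub_pos.2 (h T).2)⟩)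
  have := hu.div (hu.const_sub 1) (by norm_num)
  rwa [zero_div] at this

end ExpertPanel

theorem mainTheorem3 {Ω : Type*} [MeasurableSpace Ω] (P : MeasureTheory.Measure Ω)
    [MeasureTheory.IsProbabilityMeasure P] (N : ℕ) (hN : 2 ≤ N)
    (M : ExpertPanel.Params)
    (hμ0 : 0 < M.μ) (hμ1 : M.μ < 1) (hϖ0 : 0 < M.ϖ) (hϖ1 : M.ϖ < 1)
    (hpL : 1 / 2 ≤ M.pL) (hpLH : M.pL < M.pH) (hpH : M.pH < 1)
    (hκ : 0 ≤ M.κ)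
    (hdesign : 0 < ExpertPanel.lowerDensity M.E ∨ 0 < M.κ)
    (σ : ℝ → ExpertPanel.Rule) (hσ : ExpertPanel.IsOneSidedEquilibrium M σ)
    (θ : Ω → Bool) (τ : Fin N → Ω → Bool) (s y : ℕ → Fin N → Ω → Bool)
    (hplay : ExpertPanel.IsPlay M σ P θ τ s y) :
    ∀ᵐ ω ∂P, (∃ i, 1 / 2 < M.prec (τ i ω)) →
      Tendsto (fun T => ExpertPanel.publicBelief P θ y T ω) atTop
          (𝓝 (if θ ω = true then 1 else 0)) ∧
        Tendsto (fun T => ExpertPanel.logit (ExpertPanel.publicBelief P θ y T ω)) atTop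
          (if θ ω = true then atTop else atBot) ∧
        Tendsto (fun T => ExpertPanel.cumLogLikelihood M σ P θ τ y T ω) atTop
          (if θ ω = true then atTop else atBot) ∧
        ∀ i, Tendsto (fun T => ExpertPanel.reputation P τ y i T ω) atTop
          (𝓝 (if τ i ω = true then 1 else 0)) := by
  have hM : M.Admissible := ⟨hμ0, hμ1, hϖ0, hϖ1, hpL, hpLH, hpH, hκ⟩
  -- There are finitely many hidden states, so a single null set serves all of them, and `x` can
  -- then be the realised one.
  have h1 := MeasureTheory.ae_all_iff.2 fun x : Bool × (Fin N → Bool) =>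
    MeasureTheory.ae_all_iff.2 fun hx : ∃ i, 1 / 2 < M.prec (x.2 i) =>
      (ExpertPanel.ae_tendsto_posterior hplay hσ hM hdesign hx).and
        (ExpertPanel.ae_tendsto_cumLogLikelihood hplay hσ hM hdesign hx)
  filter_upwards [h1] with ω hω hx
  obtain ⟨hpost, hcum⟩ := hω (ExpertPanel.hidden θ τ ω) hx
  have hpost := hpost rfl
  have hl : Tendsto (fun T => ExpertPanel.publicBelief P θ y T ω) atTop
      (𝓝 (if θ ω = true then 1 else 0)) := by
    have := hpost (Finset.univ.filter fun x : Bool × (Fin N → Bool) => x.1 = true)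
    simp_rw [← ExpertPanel.belief_eq] at this
    simp only [Finset.mem_filter, Finset.mem_univ, true_and] at this
    exact this
  have hmem : ∀ T, 0 < ExpertPanel.publicBelief P θ y T ω ∧
      ExpertPanel.publicBelief P θ y T ω < 1 := fun T => hplay.belief_mem hM T _
  refine ⟨hl, ?_, hcum rfl, fun i => ?_⟩
  · cases hθ : θ ω
    · simp only [hθ, Bool.false_eq_true, if_false] at hl ⊢
      exact ExpertPanel.tendsto_logit_atBot hmem hl
    · simp only [hθ, if_true] at hl ⊢
      exact ExpertPanel.tendsto_logit_atTop hmem hl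
  · have := hpost (Finset.univ.filter fun x : Bool × (Fin N → Bool) => x.2 i = true)
    simp_rw [← ExpertPanel.reputation_eq] at this
    simpa [ExpertPanel.hidden] using this
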